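/- Let $H$ be a complex Hilbert space and $X$ a complex Banach space, with Banach duals $H'$ and $X'$. For $g\in H$ write $\overline{g}:=\langle\,\cdot\,|\,g\rangle\in H'$ (inner product linear in the first variable); $H'$ is a Hilbert space under $\langle\overline g|\overline h\rangle_{H'}:=\langle h|g\rangle_H$. A complex standard Gaussian is $\gamma=\gamma_r+\mathrm{i}\gamma_i$ with $\gamma_r,\gamma_i$ independent real standard Gaussians. For an operator $T:H\to X$ let \[\|T\|_\gamma:=\sup_F\Big(\mathbb E\big\|\textstyle\sum_{e\in F}\gamma_e\,Te\big\|_X^2\Big)^{1/2},\] the supremum taken over all finite orthonormal systems $F\subseteq H$, with $(\gamma_e)_{e\in F}$ independent complex standard Gaussians. Let $\gamma_\infty(H;X)$ be the space of all $T$ with $\|T\|_\gamma<\infty$, and let $\gamma(H;X)$ be the closure in $\gamma_\infty(H;X)$, with respect to $\|\cdot\|_\gamma$, of the finite rank operators. The spaces $\gamma_\infty(H';X')$ and $\gamma(H';X')$ are defined in the same way. An operator $T\in\mathcal L(H)$ is nuclear, $T\in\mathrm{Nuc}(H)$, if $T=\sum_n g_n'\otimes h_n$ with $g_n'\in H'$,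 $h_n\in H$ and $\sum_n\|g_n'\|\|h_n\|<\infty$; $\|T\|_{\mathrm{nuc}}$ is the infimum of these sums over all such representations, and $\mathrm{tr}(T)=\sum_n g_n'(h_n)$, which does not depend on the representation. For $V\in\mathcal L(H';X')$ with Banach space adjoint $V':X''\to H''$ and $U\in\mathcal L(H;X)$, regard $V'U$ as the operator $H\to X\subseteq X''\to H''=H$. Let \[\|V\|_{\gamma'}:=\sup\{|\mathrm{tr}(V'U)| : U\in\mathcal L(H;X),\ \|U\|_\gamma\le1,\ \dim\mathrm{ran}(U)<\infty\},\] \[\gamma'(H';X'):=\{V\in\mathcal L(H';X') : \|V\|_{\gamma'}<\infty\}.\] Then the following hold. a) If $U\in\gamma(H;X)$ and $V\in\gamma'(H';X')$, then $V'U\in\mathrm{Nuc}(H)$ and $\|V'U\|_{\mathrm{nuc}}\le\|V\|_{\gamma'}\|U\|_\gamma$. Moreover, the linear mapping $\gamma'(H';X')\to\mathcal L(\gamma(H;X);\mathrm{Nuc}(H))$, $V\mapsto(U\mapsto V'U)$, is isometric. b) The bilinear mapping $\gamma(H;X)\times\gamma'(H';X')\to\mathbb C$, $(U,V)\mapsto\langle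 U,V\rangle:=\mathrm{tr}(V'U)$, establishes an isometric isomorphism $\gamma(H;X)'\cong\gamma'(H';X')$; that is, $V\mapsto\langle\,\cdot\,,V\rangle$ is a linear isometric bijection of $\gamma'(H';X')$ onto the Banach dual of $\gamma(H;X)$. c) If $(e_\alpha)_\alpha$ is an orthonormal basis of $H$, then \[\langle U,V\rangle=\mathrm{tr}(V'U)=\sum_\alpha\langle Ue_\alpha,V\overline{e_\alpha}\rangle_{X,X'}\] (as an unconditional sum) for all $U\in\gamma(H;X)$ and $V\in\gamma'(H';X')$. d) If $V\in\gamma(H';X')$, then $V\in\gamma'(H';X')$ and $\|V\|_{\gamma'}\le\|V\|_\gamma$. -/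

import Mathlib

set_option maxSynthPendingDepth 3

open MeasureTheory ProbabilityTheory
open scoped ENNReal NNReal

/-! ### The dual of a Hilbert space -/

section HilbertDual

variable {H : Type*} [NormedAddCommGroup H] [InnerProductSpace ℂ H] [CompleteSpace H]

/-- The dual `H'` of a complex Hilbert space `H` is a Hilbert space with the inner product
`⟪toDual g, toDual h⟫ = ⟪h, g⟫`. (Mathlib's inner product is linear in the second variable, and
`InnerProductSpace.toDual ℂ H g` is the functional `h ↦ ⟪g, h⟫`.) -/
noncomputable instance hilbertDualInner : InnerProductSpace ℂ (StrongDual ℂ H) where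
  inner f g := inner ℂ ((InnerProductSpace.toDual ℂ H).symm g)
    ((InnerProductSpace.toDual ℂ H).symm f)
  norm_sq_eq_re_inner f := by
    rw [← (InnerProductSpace.toDual ℂ H).symm.norm_map f]
    exact norm_sq_eq_re_inner _
  conj_inner_symm f g := inner_conj_symm _ _
  add_left f g h := by rw [map_add, inner_add_right]
  smul_left f g r := by rw [map_smulₛₗ, inner_smul_right]

/-- A Hilbert space is reflexive. -/
theorem hilbert_bidual_surjective :
    Function.Surjective (NormedSpace.inclusionInDoubleDualLi ℂ (E := H)) := by
  intro y
  let ℓ : StrongDual ℂ H :=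
    (InnerProductSpace.toDual ℂ (StrongDual ℂ H)).symm y
  refine ⟨(InnerProductSpace.toDual ℂ H).symm ℓ, ?_⟩
  ext f
  have h1 : y f = inner ℂ ℓ f := (InnerProductSpace.toDual_symm_apply).symm
  have h2 : inner ℂ ℓ f = inner ℂ ((InnerProductSpace.toDual ℂ H).symm f)
    ((InnerProductSpace.toDual ℂ H).symm ℓ) := rfl
  rw [h1, h2, InnerProductSpace.toDual_symm_apply]
  rfl

variable (H) in
/-- The canonical identification `H = H''`, `h ↦ (f ↦ f h)`. -/
noncomputable def hilbertBidual : H ≃ₗᵢ[ℂ] StrongDual ℂ (StrongDual ℂ H) :=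
  LinearIsometryEquiv.ofSurjective (NormedSpace.inclusionInDoubleDualLi ℂ)
    hilbert_bidual_surjective

end HilbertDual

/-! ### Nuclear operators and their trace -/

section Nuclear

variable {E F : Type*} [NormedAddCommGroup E] [NormedSpace ℂ E]
  [NormedAddCommGroup F] [NormedSpace ℂ F]

/-- `T = ∑ₙ gₙ ⊗ xₙ` with `gₙ ∈ E'`, `xₙ ∈ F` and `∑ₙ ‖gₙ‖ ‖xₙ‖ < ∞`. -/
def IsNuclearRep (T : E →L[ℂ] F) (g : ℕ → StrongDual ℂ E) (x : ℕ → F) : Prop :=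
  Summable (fun n => ‖g n‖ * ‖x n‖) ∧ ∀ h, HasSum (fun n => g n h • x n) (T h)

/-- `T` is a nuclear operator. -/
def IsNuclear (T : E →L[ℂ] F) : Prop := ∃ g x, IsNuclearRep T g x

/-- The nuclear norm: the infimum of `∑ₙ ‖gₙ‖ ‖xₙ‖` over all nuclear representations. -/
noncomputable def nuclearNorm (T : E →L[ℂ] F) : ℝ :=
  sInf {r | ∃ g x, IsNuclearRep T g x ∧ r = ∑' n, ‖g n‖ * ‖x n‖}

theorem IsNuclearRep.add {S T : E →L[ℂ] F} {g k : ℕ → StrongDual ℂ E} {x y : ℕ → F}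
    (hS : IsNuclearRep S g x) (hT : IsNuclearRep T k y) :
    ∃ l z, IsNuclearRep (S + T) l z ∧
      ∑' n, ‖l n‖ * ‖z n‖ = ∑' n, ‖g n‖ * ‖x n‖ + ∑' n, ‖k n‖ * ‖y n‖ := by
  obtain ⟨e⟩ : Nonempty (ℕ ≃ ℕ ⊕ ℕ) := ⟨Equiv.natSumNatEquivNat.symm⟩
  let l : ℕ ⊕ ℕ → StrongDual ℂ E := Sum.elim g k
  let z : ℕ ⊕ ℕ → F := Sum.elim x y
  have hn : HasSum (fun s => ‖l s‖ * ‖z s‖)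
      (∑' n, ‖g n‖ * ‖x n‖ + ∑' n, ‖k n‖ * ‖y n‖) := by
    refine HasSum.sum ?_ ?_
    · exact hS.1.hasSum
    · exact hT.1.hasSum
  refine ⟨fun n => l (e n), fun n => z (e n), ⟨?_, fun h => ?_⟩, ?_⟩
  · exact (e.hasSum_iff.2 hn).summable
  · have : HasSum (fun s => l s h • z s) ((S + T) h) := by
      refine HasSum.sum ?_ ?_
      · exact hS.2 h
      · exact hT.2 h
    exact e.hasSum_iff.2 this
  · exact (e.hasSum_iff.2 hn).tsum_eq

theorem IsNuclearRep.smul {T : E →L[ℂ] F} {g : ℕ → StrongDual ℂ E} {x : ℕ → F}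
    (hT : IsNuclearRep T g x) (c : ℂ) :
    IsNuclearRep (c • T) g (fun n => c • x n) ∧
      ∑' n, ‖g n‖ * ‖c • x n‖ = ‖c‖ * ∑' n, ‖g n‖ * ‖x n‖ := by
  have h0 : (fun n => ‖g n‖ * ‖c • x n‖) = fun n => ‖c‖ * (‖g n‖ * ‖x n‖) := by
    ext n; rw [norm_smul]; ring
  refine ⟨⟨?_, fun h => ?_⟩, ?_⟩
  · rw [h0]; exact hT.1.mul_left _
  · have := (hT.2 h).const_smul c
    simpa [smul_comm c] using this
  · rw [h0, tsum_mul_left]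

theorem IsNuclear.zero : IsNuclear (0 : E →L[ℂ] F) :=
  ⟨0, 0, by simp, fun h => by simp⟩

theorem IsNuclear.add {S T : E →L[ℂ] F} (hS : IsNuclear S) (hT : IsNuclear T) :
    IsNuclear (S + T) := by
  obtain ⟨g, x, h⟩ := hS
  obtain ⟨k, y, h'⟩ := hT
  obtain ⟨l, z, h'', -⟩ := h.add h'
  exact ⟨l, z, h''⟩

theorem IsNuclear.smul {T : E →L[ℂ] F} (hT : IsNuclear T) (c : ℂ) : IsNuclear (c • T) := by
  obtain ⟨g, x, h⟩ := hT
  exact ⟨_, _, (h.smul c).1⟩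

theorem nuclearNorm_bddBelow (T : E →L[ℂ] F) :
    BddBelow {r | ∃ g x, IsNuclearRep T g x ∧ r = ∑' n, ‖g n‖ * ‖x n‖} := by
  refine ⟨0, ?_⟩
  rintro r ⟨g, x, -, rfl⟩
  exact tsum_nonneg fun n => by positivity

theorem IsNuclearRep.nuclearNorm_le {T : E →L[ℂ] F} {g : ℕ → StrongDual ℂ E} {x : ℕ → F}
    (hT : IsNuclearRep T g x) : nuclearNorm T ≤ ∑' n, ‖g n‖ * ‖x n‖ :=
  csInf_le (nuclearNorm_bddBelow T) ⟨g, x, hT, rfl⟩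

theorem nuclearNorm_nonneg (T : E →L[ℂ] F) : 0 ≤ nuclearNorm T := by
  refine Real.sInf_nonneg ?_
  rintro r ⟨g, x, -, rfl⟩
  exact tsum_nonneg fun n => by positivity

theorem IsNuclear.exists_lt {T : E →L[ℂ] F} (hT : IsNuclear T) {r : ℝ}
    (hr : nuclearNorm T < r) :
    ∃ g x, IsNuclearRep T g x ∧ ∑' n, ‖g n‖ * ‖x n‖ < r := by
  obtain ⟨g, x, h⟩ := hT
  obtain ⟨s, ⟨g, x, h, rfl⟩, hs⟩ := exists_lt_of_csInf_lt (s := {r | ∃ g x, IsNuclearRep T g x ∧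
    r = ∑' n, ‖g n‖ * ‖x n‖}) ⟨_, g, x, h, rfl⟩ hr
  exact ⟨g, x, h, hs⟩

theorem IsNuclear.nuclearNorm_add_le {S T : E →L[ℂ] F} (hS : IsNuclear S) (hT : IsNuclear T) :
    nuclearNorm (S + T) ≤ nuclearNorm S + nuclearNorm T := by
  refine le_of_forall_pos_le_add fun ε hε => ?_
  obtain ⟨g, x, h, h1⟩ := hS.exists_lt (r := nuclearNorm S + ε / 2) (by linarith)
  obtain ⟨k, y, h', h2⟩ := hT.exists_lt (r := nuclearNorm T + ε / 2) (by linarith)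
  obtain ⟨l, z, h'', h3⟩ := h.add h'
  have := h''.nuclearNorm_le
  linarith

theorem IsNuclear.nuclearNorm_smul_le {T : E →L[ℂ] F} (hT : IsNuclear T) (c : ℂ) :
    nuclearNorm (c • T) ≤ ‖c‖ * nuclearNorm T := by
  refine le_of_forall_pos_le_add fun ε hε => ?_
  have hc : 0 < ‖c‖ + 1 := by positivity
  obtain ⟨g, x, h, h1⟩ := hT.exists_lt (r := nuclearNorm T + ε / (‖c‖ + 1))
    (by have := div_pos hε hc; linarith)
  have h2 := (h.smul c).1.nuclearNorm_le
  rw [(h.smul c).2] at h2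
  have h3 : ‖c‖ * (ε / (‖c‖ + 1)) ≤ ε := by
    rw [mul_div_assoc', div_le_iff₀ hc]; nlinarith [norm_nonneg c]
  nlinarith [mul_le_mul_of_nonneg_left h1.le (norm_nonneg c)]

theorem IsNuclear.nuclearNorm_smul {T : E →L[ℂ] F} (hT : IsNuclear T) (c : ℂ) :
    nuclearNorm (c • T) = ‖c‖ * nuclearNorm T := by
  refine le_antisymm (hT.nuclearNorm_smul_le c) ?_
  rcases eq_or_ne c 0 with rfl | hc
  · simpa using nuclearNorm_nonneg _
  · have h := (hT.smul c).nuclearNorm_smul_le c⁻¹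
    rw [inv_smul_smul₀ hc, norm_inv, ← div_eq_inv_mul, le_div_iff₀ (norm_pos_iff.2 hc)] at h
    linarith

theorem IsNuclear.norm_le {T : E →L[ℂ] F} (hT : IsNuclear T) : ‖T‖ ≤ nuclearNorm T := by
  refine le_of_forall_pos_le_add fun ε hε => ?_
  obtain ⟨g, x, h, h1⟩ := hT.exists_lt (r := nuclearNorm T + ε) (by linarith)
  refine (T.opNorm_le_bound (tsum_nonneg fun n => by positivity) fun v => ?_).trans h1.le
  have hs : Summable fun n => ‖g n‖ * ‖x n‖ * ‖v‖ := h.1.mul_right _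
  rw [← (h.2 v).tsum_eq, ← tsum_mul_right]
  refine tsum_of_norm_bounded hs.hasSum fun n => ?_
  rw [norm_smul]
  nlinarith [(g n).le_opNorm v, norm_nonneg (x n)]

/-- An operator of finite rank is nuclear. -/
theorem IsNuclear.of_finiteRank (T : E →L[ℂ] F) (hT : FiniteDimensional ℂ T.range) :
    IsNuclear T := by
  let b := Module.finBasis ℂ T.range
  let d := Module.finrank ℂ T.range
  let R : E →L[ℂ] T.range := T.codRestrict T.range fun v => ⟨v, rfl⟩
  let g : Fin d → StrongDual ℂ E := fun i => (LinearMap.toContinuousLinearMap (b.coord i)).comp R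
  have hz : ∀ v, ∀ n ∉ Finset.range d,
      ((if h : n < d then g ⟨n, h⟩ else 0 : StrongDual ℂ E) v) •
        (if h : n < d then (b ⟨n, h⟩ : F) else 0) = 0 := by
    intro v n hn
    simp only [Finset.mem_range] at hn
    simp [hn]
  refine ⟨fun n => if h : n < d then g ⟨n, h⟩ else 0,
    fun n => if h : n < d then (b ⟨n, h⟩ : F) else 0, ?_, fun v => ?_⟩
  · refine summable_of_ne_finset_zero (s := Finset.range d) fun n hn => ?_
    simp only [Finset.mem_range] at hn
    simp [hn]
  · have h1 : T v = ∑ i : Fin d, g i v • (b i : F) := by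
      have := congrArg Subtype.val (b.sum_repr (R v))
      rw [Submodule.coe_sum] at this
      exact this.symm
    have h2 := hasSum_sum_of_ne_finset_zero (L := SummationFilter.unconditional ℕ) (hz v)
    rw [Finset.sum_range] at h2
    rw [h1]
    simpa using h2

variable (E F) in
/-- The linear subspace of nuclear operators from `E` to `F`. -/
def nuclearSubmodule : Submodule ℂ (E →L[ℂ] F) where
  carrier := {T | IsNuclear T}
  add_mem' := IsNuclear.add
  zero_mem' := IsNuclear.zero
  smul_mem' := fun c _ hT => IsNuclear.smul hT c

variable (E F) in
/-- The space `Nuc(E;F)` of nuclear operators from `E` to `F`, with the nuclear norm (a type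
synonym, so that it does not carry the operator norm). -/
def NuclearOp : Type _ := nuclearSubmodule E F

noncomputable instance : AddCommGroup (NuclearOp E F) :=
  inferInstanceAs (AddCommGroup (nuclearSubmodule E F))

noncomputable instance : Module ℂ (NuclearOp E F) :=
  inferInstanceAs (Module ℂ (nuclearSubmodule E F))

/-- The underlying operator of an element of `Nuc(E;F)`. -/
def NuclearOp.toCLM (T : NuclearOp E F) : E →L[ℂ] F := Subtype.val T

theorem NuclearOp.isNuclear (T : NuclearOp E F) : IsNuclear T.toCLM := Subtype.property T

noncomputable instance : Norm (NuclearOp E F) := ⟨fun T => nuclearNorm T.toCLM⟩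

theorem NuclearOp.core : NormedSpace.Core ℂ (NuclearOp E F) where
  norm_nonneg T := nuclearNorm_nonneg _
  norm_smul c T := T.isNuclear.nuclearNorm_smul c
  norm_triangle S T := S.isNuclear.nuclearNorm_add_le T.isNuclear
  norm_eq_zero_iff T := by
    constructor
    · intro h
      have h1 : ‖T.toCLM‖ ≤ 0 := T.isNuclear.norm_le.trans h.le
      exact Subtype.ext (norm_le_zero_iff.1 h1)
    · rintro rfl
      have := (IsNuclear.zero (E := E) (F := F)).nuclearNorm_smul 0
      rw [smul_zero, norm_zero, zero_mul] at this
      exact this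

noncomputable instance : NormedAddCommGroup (NuclearOp E F) :=
  NormedAddCommGroup.ofCore NuclearOp.core

noncomputable instance : NormedSpace ℂ (NuclearOp E F) :=
  NormedSpace.ofCore NuclearOp.core

open Classical in
/-- The trace of a nuclear operator `T = ∑ₙ gₙ ⊗ xₙ` on a Hilbert space is `∑ₙ gₙ(xₙ)`. By
`IsNuclearRep.nuclearTrace_eq` it does not depend on the representation; in particular, for
`T` of finite rank it can be computed from any finite representation. (For operators that
are not nuclear the value is `0` by convention.) -/
noncomputable def nuclearTrace (T : E →L[ℂ] E) : ℂ :=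
  if h : IsNuclear T then ∑' n, h.choose n (h.choose_spec.choose n) else 0

end Nuclear

section Trace

variable {H : Type*} [NormedAddCommGroup H] [InnerProductSpace ℂ H] [CompleteSpace H]

theorem IsNuclearRep.hasSum_inner {T : H →L[ℂ] H} {g : ℕ → StrongDual ℂ H} {x : ℕ → H}
    (h : IsNuclearRep T g x) {ι : Type*} (b : HilbertBasis ι ℂ H) :
    HasSum (fun i => inner ℂ (b i) (T (b i))) (∑' n, g n (x n)) := by
  let k : ℕ → H := fun n => (InnerProductSpace.toDual ℂ H).symm (g n)
  have hk : ∀ n v, g n v = inner ℂ (k n) v := fun n v =>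
    (InnerProductSpace.toDual_symm_apply).symm
  have hkn : ∀ n, ‖k n‖ = ‖g n‖ := fun n => (InnerProductSpace.toDual ℂ H).symm.norm_map _
  let G : ℕ × ι → ℂ := fun p => inner ℂ (k p.1) (b p.2) * inner ℂ (b p.2) (x p.1)
  have hfin : ∀ n (s : Finset ι), ∑ i ∈ s, ‖G (n, i)‖ ≤ ‖g n‖ * ‖x n‖ := by
    intro n s
    have h1 := Real.sum_mul_le_sqrt_mul_sqrt s (fun i => ‖inner ℂ (b i) (k n)‖)
      (fun i => ‖inner ℂ (b i) (x n)‖)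
    have h2 := b.orthonormal.sum_inner_products_le (k n) (s := s)
    have h3 := b.orthonormal.sum_inner_products_le (x n) (s := s)
    have h4 := Real.sqrt_le_sqrt h2
    have h5 := Real.sqrt_le_sqrt h3
    rw [Real.sqrt_sq (norm_nonneg _)] at h4 h5
    have h6 : ∀ i, ‖G (n, i)‖ = ‖inner ℂ (b i) (k n)‖ * ‖inner ℂ (b i) (x n)‖ := by
      intro i
      simp only [G, norm_mul]
      rw [norm_inner_symm]
    simp only [h6]
    rw [← hkn]
    exact h1.trans (mul_le_mul h4 h5 (Real.sqrt_nonneg _) (norm_nonneg _))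
  have hs : Summable fun p => ‖G p‖ := by
    refine (summable_prod_of_nonneg fun p => norm_nonneg _).2 ⟨fun n => ?_, ?_⟩
    · exact summable_of_sum_le (fun i => norm_nonneg _) (hfin n)
    · refine Summable.of_nonneg_of_le (fun n => tsum_nonneg fun i => norm_nonneg _)
        (fun n => ?_) h.1
      exact Real.tsum_le_of_sum_le (fun i => norm_nonneg _) (hfin n)
  have hG : Summable G := hs.of_norm
  have h1 : HasSum (fun n => g n (x n)) (∑' p, G p) := by
    refine hG.hasSum.prod_fiberwise fun n => ?_
    rw [hk]
    exact b.hasSum_inner_mul_inner (k n) (x n)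
  rw [h1.tsum_eq]
  have h2 : HasSum (fun p : ι × ℕ => G p.swap) (∑' p, G p) :=
    (Equiv.prodComm ι ℕ).hasSum_iff.2 hG.hasSum
  refine h2.prod_fiberwise fun i => ?_
  have h3 := (h.2 (b i)).mapL (innerSL ℂ (b i))
  simpa [G, hk] using h3

/-- The trace of a nuclear operator is independent of the representation. -/
theorem IsNuclearRep.nuclearTrace_eq {T : H →L[ℂ] H} {g : ℕ → StrongDual ℂ H} {x : ℕ → H}
    (h : IsNuclearRep T g x) : nuclearTrace T = ∑' n, g n (x n) := by
  have hT : IsNuclear T := ⟨g, x, h⟩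
  obtain ⟨w, b, -⟩ := exists_hilbertBasis ℂ H
  rw [nuclearTrace, dif_pos hT]
  exact (hT.choose_spec.choose_spec.hasSum_inner b).unique (h.hasSum_inner b)

theorem IsNuclear.hasSum_inner {T : H →L[ℂ] H} (h : IsNuclear T) {ι : Type*}
    (b : HilbertBasis ι ℂ H) : HasSum (fun i => inner ℂ (b i) (T (b i))) (nuclearTrace T) := by
  obtain ⟨g, x, h⟩ := h
  rw [h.nuclearTrace_eq]
  exact h.hasSum_inner b

theorem IsNuclear.nuclearTrace_add {S T : H →L[ℂ] H} (hS : IsNuclear S) (hT : IsNuclear T) :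
    nuclearTrace (S + T) = nuclearTrace S + nuclearTrace T := by
  obtain ⟨w, b, -⟩ := exists_hilbertBasis ℂ H
  refine ((hS.add hT).hasSum_inner b).unique ?_
  simpa [inner_add_right] using (hS.hasSum_inner b).add (hT.hasSum_inner b)

theorem IsNuclear.nuclearTrace_smul {T : H →L[ℂ] H} (hT : IsNuclear T) (c : ℂ) :
    nuclearTrace (c • T) = c * nuclearTrace T := by
  obtain ⟨w, b, -⟩ := exists_hilbertBasis ℂ H
  refine ((hT.smul c).hasSum_inner b).unique ?_
  simpa [inner_smul_right] using (hT.hasSum_inner b).mul_left c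

end Trace

/-! ### Complex Gaussians, `γ`-summing and `γ`-radonifying operators -/

/-- The law of a complex standard Gaussian random variable `γ = γᵣ + i γᵢ`, where `γᵣ` and `γᵢ`
are independent real standard Gaussians. -/
noncomputable def complexGaussian : Measure ℂ :=
  ((gaussianReal 0 1).prod (gaussianReal 0 1)).map
    (fun p : ℝ × ℝ => (p.1 : ℂ) + (p.2 : ℂ) * Complex.I)

section Gaussian

instance : IsProbabilityMeasure complexGaussian :=
  Measure.isProbabilityMeasure_map (by fun_prop)

theorem memLp_complexGaussian : MemLp (fun z : ℂ => z) 2 complexGaussian := by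
  have h1 : MemLp (fun p : ℝ × ℝ => p.1) 2 ((gaussianReal 0 1).prod (gaussianReal 0 1)) :=
    (memLp_id_gaussianReal' (μ := 0) (v := 1) 2 (by simp)).comp_measurePreserving
      measurePreserving_fst
  have h2 : MemLp (fun p : ℝ × ℝ => p.2) 2 ((gaussianReal 0 1).prod (gaussianReal 0 1)) :=
    (memLp_id_gaussianReal' (μ := 0) (v := 1) 2 (by simp)).comp_measurePreserving
      measurePreserving_snd
  rw [complexGaussian, memLp_map_measure_iff (by fun_prop) (by fun_prop)]
  have h3 : MemLp (fun p : ℝ × ℝ => (p.1 : ℂ)) 2 ((gaussianReal 0 1).prod (gaussianReal 0 1)) :=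
    h1.ofReal
  have h4 : MemLp (fun p : ℝ × ℝ => (p.2 : ℂ)) 2 ((gaussianReal 0 1).prod (gaussianReal 0 1)) :=
    h2.ofReal
  exact h3.add (h4.mul_const Complex.I)

theorem integral_re_complexGaussian (a : ℂ) :
    ∫ z, (z * a).re ∂complexGaussian = 0 := by
  have h1 : Integrable (fun p : ℝ × ℝ => p.1) ((gaussianReal 0 1).prod (gaussianReal 0 1)) :=
    ((memLp_id_gaussianReal' (μ := 0) (v := 1) 1 (by simp)).comp_measurePreserving
      measurePreserving_fst).integrable le_rfl
  have h2 : Integrable (fun p : ℝ × ℝ => p.2) ((gaussianReal 0 1).prod (gaussianReal 0 1)) :=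
    ((memLp_id_gaussianReal' (μ := 0) (v := 1) 1 (by simp)).comp_measurePreserving
      measurePreserving_snd).integrable le_rfl
  rw [complexGaussian, integral_map (by fun_prop) (by fun_prop)]
  have h3 : ∀ p : ℝ × ℝ, (((p.1 : ℂ) + (p.2 : ℂ) * Complex.I) * a).re
      = p.1 * a.re - p.2 * a.im := by
    intro p; simp
  simp only [h3]
  rw [integral_sub (h1.mul_const _) (h2.mul_const _), integral_mul_const, integral_mul_const,
    integral_fun_fst (fun x : ℝ => x), integral_fun_snd (fun x : ℝ => x)]
  simp

theorem complexGaussian_singleton_zero : complexGaussian {0} = 0 := by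
  rw [complexGaussian, Measure.map_apply (by fun_prop) (measurableSet_singleton 0)]
  refine measure_mono_null (t := {0} ×ˢ Set.univ) ?_ ?_
  · rintro ⟨p, q⟩ h
    have := congrArg Complex.re h
    simpa using this
  · have := nullSingletonClass_gaussianReal (μ := 0) (v := 1) (by simp)
    rw [Measure.prod_prod]
    simp

end Gaussian

section GammaNorm

variable {H : Type*} [NormedAddCommGroup H] [InnerProductSpace ℂ H]
  {X : Type*} [NormedAddCommGroup X] [NormedSpace ℂ X]

/-- `‖T‖_γ = sup_F (𝔼 ‖∑_{e ∈ F} γₑ T e‖²)^{1/2} ∈ [0, ∞]`, the supremum over all finite orthonormal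
systems `F ⊆ H`, with `(γₑ)_{e ∈ F}` independent complex standard Gaussians, realized as the
coordinates on the product probability space. -/
noncomputable def gammaNorm (T : H →L[ℂ] X) : ℝ≥0∞ :=
  ⨆ (F : Finset H) (_ : Orthonormal ℂ (fun e : F => (e : H))),
    eLpNorm (fun γ : F → ℂ => ∑ e : F, γ e • T e) 2 (Measure.pi fun _ => complexGaussian)

theorem gammaNorm_add_le (S T : H →L[ℂ] X) :
    gammaNorm (S + T) ≤ gammaNorm S + gammaNorm T := by
  refine iSup₂_le fun F hF => ?_
  have h : (fun γ : F → ℂ => ∑ e : F, γ e • (S + T) e) =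
      (fun γ : F → ℂ => ∑ e : F, γ e • S e) + fun γ : F → ℂ => ∑ e : F, γ e • T e := by
    ext γ; simp [Finset.sum_add_distrib]
  rw [h]
  refine (eLpNorm_add_le ?_ ?_ (by norm_num)).trans (add_le_add ?_ ?_)
  · exact (by fun_prop : Continuous fun γ : F → ℂ => ∑ e : F, γ e • S e).aestronglyMeasurable
  · exact (by fun_prop : Continuous fun γ : F → ℂ => ∑ e : F, γ e • T e).aestronglyMeasurable
  · exact le_iSup₂_of_le F hF le_rfl
  · exact le_iSup₂_of_le F hF le_rfl

theorem gammaNorm_smul (c : ℂ) (T : H →L[ℂ] X) : gammaNorm (c • T) = ‖c‖ₑ * gammaNorm T := by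
  simp only [gammaNorm, ENNReal.mul_iSup]
  refine iSup_congr fun F => iSup_congr fun hF => ?_
  have h : (fun γ : F → ℂ => ∑ e : F, γ e • (c • T) e) =
      c • fun γ : F → ℂ => ∑ e : F, γ e • T e := by
    ext γ; simp [Finset.smul_sum, smul_comm c]
  rw [h, eLpNorm_const_smul]

theorem gammaNorm_zero : gammaNorm (0 : H →L[ℂ] X) = 0 := by
  simpa using gammaNorm_smul 0 (0 : H →L[ℂ] X)

theorem eq_zero_of_gammaNorm_eq_zero {T : H →L[ℂ] X} (h : gammaNorm T = 0) : T = 0 := by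
  have key : ∀ e : H, ‖e‖ = 1 → T e = 0 := by
    intro e he
    have hF : Orthonormal ℂ (fun v : ({e} : Finset H) => (v : H)) := by
      constructor
      · rintro ⟨v, hv⟩
        rw [Finset.mem_singleton] at hv
        simpa [hv] using he
      · intro i j hij
        exact absurd (Subsingleton.elim i j) hij
    have h1 := ENNReal.iSup_eq_zero.1 (ENNReal.iSup_eq_zero.1 h {e}) hF
    have hc : Continuous fun γ : ({e} : Finset H) → ℂ =>
        ∑ v : ({e} : Finset H), γ v • T v := by fun_prop
    rw [eLpNorm_eq_zero_iff hc.aestronglyMeasurable (by norm_num)] at h1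
    by_contra hT
    let i : ({e} : Finset H) := ⟨e, by simp⟩
    have h2 : ∀ᵐ γ ∂(Measure.pi fun _ : ({e} : Finset H) => complexGaussian), γ i = 0 := by
      filter_upwards [h1] with γ hγ
      have h3 : ∑ v : ({e} : Finset H), γ v • T v = γ i • T e :=
        Fintype.sum_subsingleton _ i
      rw [h3] at hγ
      exact (smul_eq_zero.1 hγ).resolve_right hT
    have h4 : ∀ᵐ γ ∂(Measure.pi fun _ : ({e} : Finset H) => complexGaussian), γ i ≠ 0 := by
      have hp := measurePreserving_eval (fun _ : ({e} : Finset H) => complexGaussian) i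
      have h5 : ∀ᵐ z ∂complexGaussian, z ≠ 0 := by
        rw [ae_iff]
        simpa using complexGaussian_singleton_zero
      exact hp.quasiMeasurePreserving.ae h5
    obtain ⟨γ, h5, h6⟩ := (h2.and h4).exists
    exact h6 h5
  ext v
  rcases eq_or_ne v 0 with rfl | hv
  · simp
  · have := key ((‖v‖⁻¹ : ℂ) • v) (norm_smul_inv_norm hv)
    rw [map_smul, smul_eq_zero] at this
    simpa [hv] using this

theorem eLpNorm_two_sq_eq_evariance {Ω : Type*} [MeasurableSpace Ω] {μ : Measure Ω} {f : Ω → ℝ}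
    (hf : ∫ ω, f ω ∂μ = 0) : eLpNorm f 2 μ ^ 2 = evariance f μ := by
  rw [evariance, hf]
  have := eLpNorm_nnreal_pow_eq_lintegral (f := f) (μ := μ) (p := 2) (by norm_num)
  simpa using this

theorem eLpNorm_gaussianSum_le {F : Type*} [Fintype F] (a : F → ℂ) :
    eLpNorm (fun γ : F → ℂ => (∑ e, γ e * a e).re) 2 (Measure.pi fun _ => complexGaussian) ^ 2 ≤
      eLpNorm (fun z : ℂ => z) 2 complexGaussian ^ 2 * ∑ e, ‖a e‖ₑ ^ 2 := by
  let Y : F → ℂ → ℝ := fun e z => (z * a e).re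
  have hY : ∀ e, MemLp (Y e) 2 complexGaussian := fun e =>
    (memLp_complexGaussian.mul_const (a e)).re
  have hY0 : ∀ e, ∫ z, Y e z ∂complexGaussian = 0 := fun e => integral_re_complexGaussian (a e)
  have hcoord : ∀ e, MemLp (fun γ : F → ℂ => Y e (γ e)) 2
      (Measure.pi fun _ => complexGaussian) := fun e =>
    (hY e).comp_measurePreserving (measurePreserving_eval _ e)
  have hsum : (fun γ : F → ℂ => (∑ e, γ e * a e).re) = ∑ e, fun γ : F → ℂ => Y e (γ e) := by
    ext γ; simp [Y]
  have h0 : ∫ γ, (∑ e, fun γ : F → ℂ => Y e (γ e)) γ ∂(Measure.pi fun _ => complexGaussian) = 0 := by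
    simp only [Finset.sum_apply]
    rw [integral_finsetSum _ fun e _ => (hcoord e).integrable (by norm_num)]
    refine Finset.sum_eq_zero fun e _ => ?_
    rw [← hY0 e]
    exact integral_comp_eval (μ := fun _ : F => complexGaussian)
      (hY e).aestronglyMeasurable
  have hvar := variance_sum_pi hY
  have hm : MemLp (∑ e, fun γ : F → ℂ => Y e (γ e)) 2 (Measure.pi fun _ => complexGaussian) :=
    memLp_finsetSum' _ fun e _ => hcoord e
  rw [hsum, eLpNorm_two_sq_eq_evariance h0, ← ofReal_variance hm, hvar,
    ENNReal.ofReal_sum_of_nonneg fun e _ => variance_nonneg _ _, Finset.mul_sum]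
  refine Finset.sum_le_sum fun e _ => ?_
  rw [ofReal_variance (hY e), ← eLpNorm_two_sq_eq_evariance (hY0 e), ← mul_pow]
  refine pow_le_pow_left' ?_ 2
  rw [mul_comm]
  refine eLpNorm_le_mul_eLpNorm_of_ae_le_mul'' _ (by fun_prop) (Filter.Eventually.of_forall ?_)
  intro z
  rw [← enorm_mul, mul_comm (a e)]
  exact enorm_le_iff_norm_le.2 (Complex.abs_re_le_norm _)

theorem gammaNorm_rankOne_lt_top [CompleteSpace H] (f : StrongDual ℂ H) (x : X) :
    gammaNorm (f.smulRight x) < ∞ := by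
  let C := eLpNorm (fun z : ℂ => z) 2 complexGaussian
  have hC : C < ∞ := memLp_complexGaussian.2
  let k := (InnerProductSpace.toDual ℂ H).symm f
  have hk : ∀ v, f v = inner ℂ k v := fun v => (InnerProductSpace.toDual_symm_apply).symm
  have main : ∀ F : Finset H, Orthonormal ℂ (fun e : F => (e : H)) → ∀ c : ℂ, ‖c‖ = 1 →
      eLpNorm (fun γ : F → ℂ => (∑ e : F, γ e * (c * f e)).re) 2
        (Measure.pi fun _ => complexGaussian) ≤ C * ‖k‖ₑ := by
    intro F hF c hc
    refine (ENNReal.pow_le_pow_left_iff (n := 2) (by norm_num)).1 ?_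
    refine (eLpNorm_gaussianSum_le _).trans ?_
    rw [mul_pow]
    refine mul_le_mul_right ?_ _
    have h1 := hF.sum_inner_products_le k (s := Finset.univ)
    have h2 : ∀ e : F, ‖c * f e‖ₑ ^ 2 = ENNReal.ofReal (‖inner ℂ (e : H) k‖ ^ 2) := by
      intro e
      rw [ENNReal.ofReal_pow (norm_nonneg _), ofReal_norm, enorm_mul, hk]
      rw [← ofReal_norm, ← ofReal_norm, ← ofReal_norm, hc,
        norm_inner_symm]
      simp
    simp only [h2]
    rw [← ENNReal.ofReal_sum_of_nonneg fun e _ => by positivity, ← ofReal_norm,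
      ← ENNReal.ofReal_pow (norm_nonneg _)]
    exact ENNReal.ofReal_le_ofReal h1
  have hfin : ‖x‖ₑ * (C * ‖k‖ₑ + C * ‖k‖ₑ) < ∞ := by
    have : C * ‖k‖ₑ < ∞ := ENNReal.mul_lt_top hC enorm_lt_top
    exact ENNReal.mul_lt_top enorm_lt_top (ENNReal.add_lt_top.2 ⟨this, this⟩)
  refine lt_of_le_of_lt (iSup₂_le fun F hF => ?_) hfin
  let A : (F → ℂ) → ℝ := fun γ => (∑ e : F, γ e * (1 * f e)).re
  let B : (F → ℂ) → ℝ := fun γ => (∑ e : F, γ e * (-Complex.I * f e)).re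
  have hA : Continuous A := by fun_prop
  have hB : Continuous B := by fun_prop
  have h1 : eLpNorm (fun γ => |A γ| + |B γ|) 2 (Measure.pi fun _ => complexGaussian) ≤
      C * ‖k‖ₑ + C * ‖k‖ₑ := by
    refine (eLpNorm_add_le (f := fun γ => |A γ|) (g := fun γ => |B γ|)
      hA.abs.aestronglyMeasurable hB.abs.aestronglyMeasurable (by norm_num)).trans ?_
    refine add_le_add ?_ ?_
    · exact (eLpNorm_norm A).le.trans (main F hF 1 (by simp))
    · exact (eLpNorm_norm B).le.trans (main F hF (-Complex.I) (by simp))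
  refine le_trans ?_ (mul_le_mul_right h1 _)
  refine eLpNorm_le_mul_eLpNorm_of_ae_le_mul'' _
    (hA.abs.add hB.abs).aestronglyMeasurable (Filter.Eventually.of_forall fun γ => ?_)
  have h2 : ∑ e : F, γ e • (f.smulRight x) e = (∑ e : F, γ e * f e) • x := by
    simp [Finset.sum_smul, smul_smul]
  have h3 : B γ = (∑ e : F, γ e * f e).im := by
    have : ∑ e : F, γ e * (-Complex.I * f e) = -Complex.I * ∑ e : F, γ e * f e := by
      rw [Finset.mul_sum]; exact Finset.sum_congr rfl fun e _ => by ring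
    simp only [B, this]
    simp
  have h4 : A γ = (∑ e : F, γ e * f e).re := by simp [A]
  rw [h2, enorm_smul, mul_comm]
  refine mul_le_mul_right ?_ _
  refine enorm_le_iff_norm_le.2 ?_
  rw [h3, h4, Real.norm_of_nonneg (by positivity)]
  exact Complex.norm_le_abs_re_add_abs_im _

end GammaNorm

section GammaSpaces

variable (H : Type*) [NormedAddCommGroup H] [InnerProductSpace ℂ H]
  (X : Type*) [NormedAddCommGroup X] [NormedSpace ℂ X]

/-- The linear subspace of `γ`-summing operators. (A linear operator `T` with `‖T‖_γ < ∞` is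
automatically bounded, so nothing is lost by starting from bounded operators.) -/
def gammaSummingSubmodule : Submodule ℂ (H →L[ℂ] X) where
  carrier := {T | gammaNorm T < ∞}
  add_mem' := fun hS hT => (gammaNorm_add_le _ _).trans_lt (ENNReal.add_lt_top.2 ⟨hS, hT⟩)
  zero_mem' := by simp [gammaNorm_zero]
  smul_mem' := fun c T hT => by
    simp only [Set.mem_ofPred_eq, gammaNorm_smul]
    exact ENNReal.mul_lt_top enorm_lt_top hT

/-- The space `γ_∞(H;X)` of `γ`-summing operators, with the norm `‖·‖_γ` (a type synonym, so that
it does not carry the operator norm). -/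
def GammaSumming : Type _ := gammaSummingSubmodule H X

noncomputable instance : AddCommGroup (GammaSumming H X) :=
  inferInstanceAs (AddCommGroup (gammaSummingSubmodule H X))

noncomputable instance : Module ℂ (GammaSumming H X) :=
  inferInstanceAs (Module ℂ (gammaSummingSubmodule H X))

variable {H X}

/-- The underlying operator of an element of `γ_∞(H;X)`. -/
def GammaSumming.toCLM (T : GammaSumming H X) : H →L[ℂ] X := Subtype.val T

theorem GammaSumming.gammaNorm_lt_top (T : GammaSumming H X) : gammaNorm T.toCLM < ∞ :=
  Subtype.property T

noncomputable instance : Norm (GammaSumming H X) := ⟨fun T => (gammaNorm T.toCLM).toReal⟩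

theorem GammaSumming.core : NormedSpace.Core ℂ (GammaSumming H X) where
  norm_nonneg T := ENNReal.toReal_nonneg
  norm_smul c T := by
    have := congrArg ENNReal.toReal (gammaNorm_smul c T.toCLM)
    rwa [ENNReal.toReal_mul, toReal_enorm] at this
  norm_triangle S T := by
    have h := ENNReal.toReal_mono
      (ENNReal.add_lt_top.2 ⟨S.gammaNorm_lt_top, T.gammaNorm_lt_top⟩).ne
      (gammaNorm_add_le S.toCLM T.toCLM)
    rwa [ENNReal.toReal_add S.gammaNorm_lt_top.ne T.gammaNorm_lt_top.ne] at h
  norm_eq_zero_iff T := by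
    constructor
    · intro h
      have h1 : gammaNorm T.toCLM = 0 :=
        ((ENNReal.toReal_eq_zero_iff _).1 h).resolve_right T.gammaNorm_lt_top.ne
      exact Subtype.ext (eq_zero_of_gammaNorm_eq_zero h1)
    · rintro rfl
      exact (congrArg ENNReal.toReal (gammaNorm_zero (H := H) (X := X))).trans ENNReal.toReal_zero

noncomputable instance : NormedAddCommGroup (GammaSumming H X) :=
  NormedAddCommGroup.ofCore GammaSumming.core

noncomputable instance : NormedSpace ℂ (GammaSumming H X) :=
  NormedSpace.ofCore GammaSumming.core

theorem finiteDimensional_range_add {S T : H →L[ℂ] X} (hS : FiniteDimensional ℂ S.range)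
    (hT : FiniteDimensional ℂ T.range) : FiniteDimensional ℂ (S + T).range := by
  refine Submodule.finiteDimensional_of_le (S₂ := S.range ⊔ T.range) ?_
  rintro _ ⟨v, rfl⟩
  exact Submodule.add_mem_sup ⟨v, rfl⟩ ⟨v, rfl⟩

theorem finiteDimensional_range_smul {T : H →L[ℂ] X} (c : ℂ)
    (hT : FiniteDimensional ℂ T.range) : FiniteDimensional ℂ (c • T).range := by
  refine Submodule.finiteDimensional_of_le (S₂ := T.range) ?_
  rintro _ ⟨v, rfl⟩
  exact T.range.smul_mem c ⟨v, rfl⟩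

variable (H X)

/-- The subspace of finite rank operators in `γ_∞(H;X)`. -/
def finiteRankGamma : Submodule ℂ (GammaSumming H X) where
  carrier := {T | FiniteDimensional ℂ T.toCLM.range}
  add_mem' := finiteDimensional_range_add
  zero_mem' := by
    refine Submodule.finiteDimensional_of_le (S₂ := (⊥ : Submodule ℂ X)) ?_
    rintro _ ⟨v, rfl⟩
    rfl
  smul_mem' := fun c _ hT => finiteDimensional_range_smul c hT

/-- The space `γ(H;X)` of `γ`-radonifying operators: the closure of the finite rank operators in
`γ_∞(H;X)`, with the norm `‖·‖_γ`. -/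
abbrev GammaRad : Type _ := (finiteRankGamma H X).topologicalClosure

variable {H X}

/-- The underlying operator of an element of `γ(H;X)`. -/
def GammaRad.toCLM (T : GammaRad H X) : H →L[ℂ] X := (T : GammaSumming H X).toCLM

end GammaSpaces

/-! ### Trace duality -/

section Duality

variable {H : Type*} [NormedAddCommGroup H] [InnerProductSpace ℂ H] [CompleteSpace H]
  {X : Type*} [NormedAddCommGroup X] [NormedSpace ℂ X]

/-- For `V : H' → X'` and `U : H → X` the operator `V'U : H → X ⊆ X'' → H'' = H`, where
`V' : X'' → H''` is the Banach space adjoint of `V`. -/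
noncomputable def dualComp (V : StrongDual ℂ H →L[ℂ] StrongDual ℂ X) (U : H →L[ℂ] X) :
    H →L[ℂ] H :=
  ((hilbertBidual H).symm.toContinuousLinearEquiv :
      StrongDual ℂ (StrongDual ℂ H) →L[ℂ] H) ∘L
    (ContinuousLinearMap.precomp ℂ V :
      StrongDual ℂ (StrongDual ℂ X) →L[ℂ] StrongDual ℂ (StrongDual ℂ H)) ∘L
    NormedSpace.inclusionInDoubleDual ℂ X ∘L U

theorem apply_dualComp (V : StrongDual ℂ H →L[ℂ] StrongDual ℂ X) (U : H →L[ℂ] X)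
    (f : StrongDual ℂ H) (h : H) : f (dualComp V U h) = V f (U h) := by
  have h1 : ∀ y, hilbertBidual H y f = f y := fun y => rfl
  rw [← h1]
  have h2 : hilbertBidual H (dualComp V U h) = ContinuousLinearMap.precomp ℂ V
      (NormedSpace.inclusionInDoubleDual ℂ X (U h)) :=
    (hilbertBidual H).apply_symm_apply _
  rw [h2]
  rfl

theorem eq_of_forall_dual {a b : H} (h : ∀ f : StrongDual ℂ H, f a = f b) : a = b :=
  (hilbertBidual H).injective (ContinuousLinearMap.ext h)

theorem dualComp_add (V W : StrongDual ℂ H →L[ℂ] StrongDual ℂ X) (U : H →L[ℂ] X) :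
    dualComp (V + W) U = dualComp V U + dualComp W U := by
  ext h
  refine eq_of_forall_dual fun f => ?_
  simp [apply_dualComp]

theorem dualComp_smul (c : ℂ) (V : StrongDual ℂ H →L[ℂ] StrongDual ℂ X) (U : H →L[ℂ] X) :
    dualComp (c • V) U = c • dualComp V U := by
  ext h
  refine eq_of_forall_dual fun f => ?_
  simp [apply_dualComp]

theorem dualComp_smul_right (c : ℂ) (V : StrongDual ℂ H →L[ℂ] StrongDual ℂ X) (U : H →L[ℂ] X) :
    dualComp V (c • U) = c • dualComp V U := by
  ext h
  refine eq_of_forall_dual fun f => ?_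
  simp [apply_dualComp]

theorem isNuclear_dualComp (V : StrongDual ℂ H →L[ℂ] StrongDual ℂ X) {U : H →L[ℂ] X}
    (hU : FiniteDimensional ℂ U.range) : IsNuclear (dualComp V U) := by
  refine IsNuclear.of_finiteRank _ ?_
  let W : X →L[ℂ] H := ((hilbertBidual H).symm.toContinuousLinearEquiv :
      StrongDual ℂ (StrongDual ℂ H) →L[ℂ] H) ∘L
    (ContinuousLinearMap.precomp ℂ V :
      StrongDual ℂ (StrongDual ℂ X) →L[ℂ] StrongDual ℂ (StrongDual ℂ H)) ∘L
    NormedSpace.inclusionInDoubleDual ℂ X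
  refine Submodule.finiteDimensional_of_le (S₂ := U.range.map (W : X →ₗ[ℂ] H)) ?_
  rintro _ ⟨v, rfl⟩
  exact ⟨U v, ⟨v, rfl⟩, rfl⟩

/-- `tr(V'(f ⊗ x)) = ⟨x, V f⟩`. -/
theorem nuclearTrace_dualComp_rankOne (V : StrongDual ℂ H →L[ℂ] StrongDual ℂ X)
    (f : StrongDual ℂ H) (x : X) : nuclearTrace (dualComp V (f.smulRight x)) = V f x := by
  let k : H := (hilbertBidual H).symm
    (ContinuousLinearMap.precomp ℂ V (NormedSpace.inclusionInDoubleDual ℂ X x))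
  have hk : ∀ f' : StrongDual ℂ H, f' k = V f' x := by
    intro f'
    have h1 : ∀ y, hilbertBidual H y f' = f' y := fun y => rfl
    rw [← h1]
    simp [k]
  have hz : ∀ n : ℕ, n ∉ ({0} : Finset ℕ) → n ≠ 0 := fun n hn => by simpa using hn
  have hrep : IsNuclearRep (dualComp V (f.smulRight x)) (fun n => if n = 0 then f else 0)
      (fun n => if n = 0 then k else 0) := by
    refine ⟨summable_of_ne_finset_zero (s := {0}) fun n hn => by simp [hz n hn], fun h => ?_⟩
    have h1 : dualComp V (f.smulRight x) h = f h • k := by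
      refine eq_of_forall_dual fun f' => ?_
      simp [apply_dualComp, hk]
    rw [h1]
    convert hasSum_single (f := fun n : ℕ => (if n = 0 then f else 0 : StrongDual ℂ H) h •
      (if n = 0 then k else 0)) 0 (fun n hn => by simp [hn]) using 1
    simp
  rw [hrep.nuclearTrace_eq, tsum_eq_single 0 fun n hn => by simp [hn]]
  simp [hk]

/-- `‖V‖_{γ'} = sup {|tr(V'U)| : U ∈ L(H;X), ‖U‖_γ ≤ 1, dim ran U < ∞} ∈ [0, ∞]`. -/
noncomputable def gammaDualNorm (V : StrongDual ℂ H →L[ℂ] StrongDual ℂ X) : ℝ≥0∞ :=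
  ⨆ (U : H →L[ℂ] X) (_ : gammaNorm U ≤ 1 ∧ FiniteDimensional ℂ U.range),
    ‖nuclearTrace (dualComp V U)‖ₑ

theorem gammaDualNorm_add_le (V W : StrongDual ℂ H →L[ℂ] StrongDual ℂ X) :
    gammaDualNorm (V + W) ≤ gammaDualNorm V + gammaDualNorm W := by
  refine iSup₂_le fun U hU => ?_
  rw [dualComp_add, (isNuclear_dualComp V hU.2).nuclearTrace_add (isNuclear_dualComp W hU.2)]
  refine (enorm_add_le _ _).trans (add_le_add ?_ ?_)
  · exact le_iSup₂_of_le U hU le_rfl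
  · exact le_iSup₂_of_le U hU le_rfl

theorem gammaDualNorm_smul (c : ℂ) (V : StrongDual ℂ H →L[ℂ] StrongDual ℂ X) :
    gammaDualNorm (c • V) = ‖c‖ₑ * gammaDualNorm V := by
  simp only [gammaDualNorm, ENNReal.mul_iSup]
  refine iSup_congr fun U => iSup_congr fun hU => ?_
  rw [dualComp_smul, (isNuclear_dualComp V hU.2).nuclearTrace_smul, enorm_mul]

theorem gammaDualNorm_zero : gammaDualNorm (0 : StrongDual ℂ H →L[ℂ] StrongDual ℂ X) = 0 := by
  simpa using gammaDualNorm_smul 0 (0 : StrongDual ℂ H →L[ℂ] StrongDual ℂ X)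

theorem eq_zero_of_gammaDualNorm_eq_zero {V : StrongDual ℂ H →L[ℂ] StrongDual ℂ X}
    (h : gammaDualNorm V = 0) : V = 0 := by
  ext f x
  let U : H →L[ℂ] X := f.smulRight x
  let c : ℝ := (gammaNorm U).toReal + 1
  have hc : 0 < c := by positivity
  have hU : FiniteDimensional ℂ U.range := by
    refine Submodule.finiteDimensional_of_le (S₂ := ℂ ∙ x) ?_
    rintro _ ⟨v, rfl⟩
    exact Submodule.mem_span_singleton.2 ⟨f v, rfl⟩
  have hle : gammaNorm ((c⁻¹ : ℂ) • U) ≤ 1 := by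
    rw [gammaNorm_smul, ← ENNReal.ofReal_toReal (gammaNorm_rankOne_lt_top f x).ne,
      ← ofReal_norm, ← ENNReal.ofReal_mul (norm_nonneg _)]
    rw [ENNReal.ofReal_le_one, norm_inv, Complex.norm_real, Real.norm_of_nonneg hc.le,
      ← div_eq_inv_mul, div_le_one hc]
    simp [c, U]
  have h1 := ENNReal.iSup_eq_zero.1 (ENNReal.iSup_eq_zero.1 h ((c⁻¹ : ℂ) • U))
    ⟨hle, finiteDimensional_range_smul _ hU⟩
  rw [dualComp_smul_right, (isNuclear_dualComp V hU).nuclearTrace_smul,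
    nuclearTrace_dualComp_rankOne, enorm_eq_zero, mul_eq_zero] at h1
  refine h1.resolve_left ?_
  simpa using hc.ne'

variable (H X) in
/-- The linear subspace `{V ∈ L(H';X') : ‖V‖_{γ'} < ∞}`. -/
def gammaDualSubmodule : Submodule ℂ (StrongDual ℂ H →L[ℂ] StrongDual ℂ X) where
  carrier := {V | gammaDualNorm V < ∞}
  add_mem' := fun hS hT => (gammaDualNorm_add_le _ _).trans_lt (ENNReal.add_lt_top.2 ⟨hS, hT⟩)
  zero_mem' := by simp [gammaDualNorm_zero]
  smul_mem' := fun c T hT => by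
    simp only [Set.mem_ofPred_eq, gammaDualNorm_smul]
    exact ENNReal.mul_lt_top enorm_lt_top hT

variable (H X) in
/-- The space `γ'(H';X') = {V ∈ L(H';X') : ‖V‖_{γ'} < ∞}`, with the norm `‖·‖_{γ'}` (a type
synonym, so that it does not carry the operator norm). -/
def GammaDual : Type _ := gammaDualSubmodule H X

noncomputable instance : AddCommGroup (GammaDual H X) :=
  inferInstanceAs (AddCommGroup (gammaDualSubmodule H X))

noncomputable instance : Module ℂ (GammaDual H X) :=
  inferInstanceAs (Module ℂ (gammaDualSubmodule H X))

/-- The underlying operator `H' → X'` of an element of `γ'(H';X')`. -/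
def GammaDual.toCLM (V : GammaDual H X) : StrongDual ℂ H →L[ℂ] StrongDual ℂ X := Subtype.val V

theorem GammaDual.gammaDualNorm_lt_top (V : GammaDual H X) : gammaDualNorm V.toCLM < ∞ :=
  Subtype.property V

noncomputable instance : Norm (GammaDual H X) := ⟨fun V => (gammaDualNorm V.toCLM).toReal⟩

theorem GammaDual.core : NormedSpace.Core ℂ (GammaDual H X) where
  norm_nonneg V := ENNReal.toReal_nonneg
  norm_smul c V := by
    have := congrArg ENNReal.toReal (gammaDualNorm_smul c V.toCLM)
    rwa [ENNReal.toReal_mul, toReal_enorm] at this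
  norm_triangle V W := by
    have h := ENNReal.toReal_mono
      (ENNReal.add_lt_top.2 ⟨V.gammaDualNorm_lt_top, W.gammaDualNorm_lt_top⟩).ne
      (gammaDualNorm_add_le V.toCLM W.toCLM)
    rwa [ENNReal.toReal_add V.gammaDualNorm_lt_top.ne W.gammaDualNorm_lt_top.ne] at h
  norm_eq_zero_iff V := by
    constructor
    · intro h
      have h1 : gammaDualNorm V.toCLM = 0 :=
        ((ENNReal.toReal_eq_zero_iff _).1 h).resolve_right V.gammaDualNorm_lt_top.ne
      exact Subtype.ext (eq_zero_of_gammaDualNorm_eq_zero h1)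
    · rintro rfl
      exact (congrArg ENNReal.toReal (gammaDualNorm_zero (H := H) (X := X))).trans
        ENNReal.toReal_zero

noncomputable instance : NormedAddCommGroup (GammaDual H X) :=
  NormedAddCommGroup.ofCore GammaDual.core

noncomputable instance : NormedSpace ℂ (GammaDual H X) :=
  NormedSpace.ofCore GammaDual.core

end Duality

/-! ### Unitary invariance of complex Gaussian vectors -/

section GaussianInvariance

/-! Everything rests on the invariance of a standard complex Gaussian vector under matrices with
orthonormal rows. It makes the `γ`-norm of a finite rank operator `∑ f̄ᵢ ⊗ xᵢ`, with `fᵢ`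
orthonormal, controlled by the single Gaussian sum `∑ γᵢ xᵢ`, whatever orthonormal system is tested.

The heart is the nuclear estimate for `U` of finite rank. Take a singular value decomposition of `T
= V'U`: orthonormal `wᵢ` with `T = ∑ w̄ᵢ ⊗ T wᵢ` and the `T wᵢ` pairwise orthogonal. Then `‖T‖_nuc ≤
∑ ‖T wᵢ‖`. With `fᵢ = T wᵢ / ‖T wᵢ‖` over the nonzero terms, put `S = ∑ f̄ᵢ ⊗ U wᵢ`. Gaussian
invariance gives `‖S‖_γ ≤ ‖U‖_γ`, while `tr(V'S) = ∑ ⟨T wᵢ, fᵢ⟩ = ∑ ‖T wᵢ‖`. So testing `V` against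
`S` bounds the nuclear norm of `V'U` by `‖V‖_{γ'} ‖U‖_γ`
(`nuclearNorm_dualComp_le_of_finiteDimensional_range`).

Since `Nuc(H)` is complete, `U ↦ V'U` extends from the dense finite rank operators to `γ(H;X)`;
since `‖·‖_γ` and `‖·‖_nuc` dominate the operator norm, the extension is still composition. The
bound `|tr T| ≤ ‖T‖_nuc` gives the reverse inequality for both isometries. For surjectivity, a
functional `φ` determines `V` by `⟨x, V f⟩ = φ(f ⊗ x)`, and rank one operators span the finite rank
ones. The basis formula is the trace of a nuclear operator computed in an orthonormal basis.
Finally, `‖V‖_{γ'} ≤ ‖V‖_γ` is Cauchy–Schwarz for the pairing of two Gaussian sums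
(`enorm_sum_apply_le_gaussianSumNorm`). -/

theorem charFun_complexGaussian (t : ℂ) :
    charFun complexGaussian t = Complex.exp (-(‖t‖ ^ 2 : ℝ) / 2) := by
  rw [charFun_apply, complexGaussian, integral_map (by fun_prop) (by fun_prop)]
  have h : ∀ p : ℝ × ℝ, Complex.exp ((inner ℝ ((p.1 : ℂ) + (p.2 : ℂ) * Complex.I) t : ℝ) * Complex.I)
      = Complex.exp (t.re * p.1 * Complex.I) * Complex.exp (t.im * p.2 * Complex.I) := by
    intro p
    rw [← Complex.exp_add]
    congr 1
    simp [Complex.inner]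
    ring
  simp only [h]
  rw [integral_prod_mul (fun x : ℝ => Complex.exp (t.re * x * Complex.I))
    (fun x : ℝ => Complex.exp (t.im * x * Complex.I)), ← charFun_apply_real, ← charFun_apply_real,
    charFun_gaussianReal, charFun_gaussianReal, ← Complex.exp_add]
  congr 1
  rw [Complex.sq_norm, Complex.normSq_apply]
  push_cast
  simp
  ring

/-- The characteristic function of the Gaussian vector depends only on the norm of its argument, and
orthonormality of the rows of `C` says that `C*` is isometric. Rectangular `C` is allowed, so the
result also covers restriction to fewer coordinates. -/
theorem map_pi_complexGaussian {ι κ : Type*} [Fintype ι] [Fintype κ] [DecidableEq ι]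
    (C : ι → κ → ℂ)
    (hC : ∀ i j, ∑ k, C i k * starRingEnd ℂ (C j k) = if i = j then 1 else 0) :
    (Measure.pi fun _ : κ => complexGaussian).map (fun γ i => ∑ k, C i k * γ k) =
      Measure.pi fun _ : ι => complexGaussian := by
  have hm : Measurable fun (γ : κ → ℂ) (i : ι) => ∑ k, C i k * γ k := by fun_prop
  have := Measure.isProbabilityMeasure_map (μ := Measure.pi fun _ : κ => complexGaussian)
    hm.aemeasurable
  refine charFun_eq_pi_iff.1 fun t => ?_
  -- `s = C* t`, so that `⟨Cγ, t⟩ = ⟨γ, s⟩`.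
  let s : κ → ℂ := fun k => ∑ i, starRingEnd ℂ (C i k) * t i
  have hs : ∑ k, ‖s k‖ ^ 2 = ∑ i, ‖t i‖ ^ 2 := by
    have h0 : ∀ z : ℂ, ((‖z‖ ^ 2 : ℝ) : ℂ) = starRingEnd ℂ z * z := fun z => by
      rw [mul_comm, Complex.mul_conj, Complex.sq_norm]
    have h1 : ((∑ k, ‖s k‖ ^ 2 : ℝ) : ℂ) = ((∑ i, ‖t i‖ ^ 2 : ℝ) : ℂ) := by
      rw [Complex.ofReal_sum, Complex.ofReal_sum]
      simp only [h0]
      calc ∑ k, starRingEnd ℂ (s k) * s k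
          = ∑ i, ∑ j, starRingEnd ℂ (t i) * t j * ∑ k, C i k * starRingEnd ℂ (C j k) := by
            simp only [s, map_sum, map_mul, Complex.conj_conj]
            simp only [Finset.sum_mul_sum]
            simp only [Finset.mul_sum]
            rw [Finset.sum_comm]
            refine Finset.sum_congr rfl fun i _ => ?_
            rw [Finset.sum_comm]
            refine Finset.sum_congr rfl fun j _ => Finset.sum_congr rfl fun k _ => ?_
            ring
        _ = ∑ i, starRingEnd ℂ (t i) * t i := by
            simp [hC]
    exact_mod_cast h1
  have h2 : charFun (((Measure.pi fun _ : κ => complexGaussian).map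
      (fun γ i => ∑ k, C i k * γ k)).map (WithLp.toLp 2)) t =
      charFun ((Measure.pi fun _ : κ => complexGaussian).map (WithLp.toLp 2))
        (WithLp.toLp 2 s) := by
    rw [charFun_apply, charFun_apply, integral_map (by fun_prop) (by fun_prop),
      integral_map hm.aemeasurable (by fun_prop), integral_map (by fun_prop) (by fun_prop)]
    refine integral_congr_ae (Filter.Eventually.of_forall fun γ => ?_)
    simp only
    congr 3
    rw [PiLp.inner_apply, PiLp.inner_apply]
    simp only [Complex.inner, s, ← Complex.re_sum, map_sum, map_mul, Finset.mul_sum,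
      Finset.sum_mul]
    rw [Finset.sum_comm]
    congr 1
    refine Finset.sum_congr rfl fun k _ => Finset.sum_congr rfl fun i _ => ?_
    ring
  rw [h2, charFun_pi]
  simp only [charFun_complexGaussian, ← Complex.exp_sum, ← Finset.sum_div, Finset.sum_neg_distrib,
    ← Complex.ofReal_sum, hs]

/-- Conjugation is a real isometry of `ℂ`. It is not complex linear, so unitary invariance does not
cover it; it is needed to pair a Gaussian sum with a conjugate one. -/
theorem map_conj_complexGaussian :
    complexGaussian.map (starRingEnd ℂ) = complexGaussian := by
  have hc : Measurable (starRingEnd ℂ) := Complex.continuous_conj.measurable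
  have := Measure.isProbabilityMeasure_map (μ := complexGaussian) hc.aemeasurable
  refine Measure.ext_of_charFun (funext fun t => ?_)
  have h : charFun (complexGaussian.map (starRingEnd ℂ)) t =
      charFun complexGaussian (starRingEnd ℂ t) := by
    rw [charFun_apply, charFun_apply, integral_map hc.aemeasurable (by fun_prop)]
    simp [Complex.inner]
  rw [h, charFun_complexGaussian, charFun_complexGaussian, RCLike.norm_conj]

variable {X : Type*} [NormedAddCommGroup X] [NormedSpace ℂ X]

/-- The `L²`-norm `(𝔼 ‖∑ᵢ γᵢ xᵢ‖²)^{1/2}` of a finite complex Gaussian sum. -/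
noncomputable def gaussianSumNorm {ι : Type*} [Fintype ι] (x : ι → X) : ℝ≥0∞ :=
  eLpNorm (fun γ : ι → ℂ => ∑ i, γ i • x i) 2 (Measure.pi fun _ => complexGaussian)

theorem continuous_gaussianSum {ι : Type*} [Fintype ι] (x : ι → X) :
    Continuous fun γ : ι → ℂ => ∑ i, γ i • x i := by fun_prop

/-- Interchanging the sums moves `C` from the vectors to the Gaussians: `∑ₖ γₖ ∑ᵢ Cᵢₖ xᵢ = ∑ᵢ (Cγ)ᵢ
xᵢ`, and `Cγ` has the law of a standard vector. -/
theorem gaussianSumNorm_comp {ι κ : Type*} [Fintype ι] [Fintype κ] [DecidableEq ι]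
    (C : ι → κ → ℂ)
    (hC : ∀ i j, ∑ k, C i k * starRingEnd ℂ (C j k) = if i = j then 1 else 0) (x : ι → X) :
    gaussianSumNorm (fun k => ∑ i, C i k • x i) = gaussianSumNorm x := by
  have hm : Measurable fun (γ : κ → ℂ) (i : ι) => ∑ k, C i k * γ k := by fun_prop
  unfold gaussianSumNorm
  rw [← map_pi_complexGaussian C hC, eLpNorm_map_measure
    (continuous_gaussianSum x).aestronglyMeasurable hm.aemeasurable]
  congr 1
  ext γ
  simp only [Function.comp, Finset.smul_sum, Finset.sum_smul, smul_smul]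
  rw [Finset.sum_comm]
  refine Finset.sum_congr rfl fun i _ => Finset.sum_congr rfl fun k _ => ?_
  rw [mul_comm]

theorem gaussianSumNorm_reindex {ι κ : Type*} [Fintype ι] [Fintype κ] (e : κ ≃ ι) (x : ι → X) :
    gaussianSumNorm (fun k => x (e k)) = gaussianSumNorm x := by
  classical
  rw [← gaussianSumNorm_comp (fun i k => if e k = i then 1 else 0) _ x]
  · simp
  · intro i j
    rw [← e.symm.sum_comp]
    simp [eq_comm]

/-- Deleting terms is averaging `x` with a sign-changed copy of `x`, and a sign change is unitary.
-/
theorem gaussianSumNorm_ite_le {ι : Type*} [Fintype ι] (p : ι → Prop) [DecidablePred p]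
    (x : ι → X) : gaussianSumNorm (fun i => if p i then x i else 0) ≤ gaussianSumNorm x := by
  classical
  let ε : ι → ℂ := fun i => if p i then 1 else -1
  have h1 : gaussianSumNorm (fun i => ε i • x i) = gaussianSumNorm x := by
    rw [← gaussianSumNorm_comp (fun i k => if i = k then ε i else 0) _ x]
    · simp
    · intro i j
      by_cases h : i = j
      · subst h
        by_cases hp : p i <;> simp [ε, hp]
      · simp [h, Ne.symm h]
  have h2 : (fun γ : ι → ℂ => ∑ i, γ i • (if p i then x i else 0)) =
      (2⁻¹ : ℂ) • ((fun γ : ι → ℂ => ∑ i, γ i • x i) + fun γ : ι → ℂ => ∑ i, γ i • ε i • x i) := by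
    ext γ
    simp only [Pi.smul_apply, Pi.add_apply, ← Finset.sum_add_distrib, Finset.smul_sum]
    refine Finset.sum_congr rfl fun i _ => ?_
    by_cases hp : p i
    · simp only [hp, ε, if_true, one_smul]
      rw [← two_smul ℂ (γ i • x i), smul_smul]
      norm_num
    · simp [hp, ε]
  have h3 : gaussianSumNorm (fun i => if p i then x i else 0) ≤
      ‖(2⁻¹ : ℂ)‖ₑ * (gaussianSumNorm x + gaussianSumNorm x) := by
    conv_lhs => rw [gaussianSumNorm, h2, eLpNorm_const_smul]
    refine mul_le_mul_right ((eLpNorm_add_le (continuous_gaussianSum x).aestronglyMeasurable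
      (continuous_gaussianSum fun i => ε i • x i).aestronglyMeasurable (by norm_num)).trans ?_) _
    exact add_le_add le_rfl h1.le
  refine h3.trans_eq ?_
  rw [← two_mul, ← mul_assoc]
  have : ‖(2⁻¹ : ℂ)‖ₑ = 2⁻¹ := by
    rw [enorm_inv (by norm_num)]
    congr 1
    rw [← ofReal_norm]
    norm_num
  rw [this, ENNReal.inv_mul_cancel (by norm_num) (by norm_num), one_mul]

/-- The subfamily has the same norm as its extension by zero to `ι`, because the incidence matrix of
the injection `j` has orthonormal rows; that extension arises from `x` by deleting terms. -/
theorem gaussianSumNorm_comp_injective_le {ι κ : Type*} [Fintype ι] [Fintype κ] {j : κ → ι}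
    (hj : Function.Injective j) (x : ι → X) :
    gaussianSumNorm (fun k => x (j k)) ≤ gaussianSumNorm x := by
  classical
  have h1 : gaussianSumNorm (fun i => ∑ k, (if j k = i then (1 : ℂ) else 0) • x (j k)) =
      gaussianSumNorm fun k => x (j k) := by
    refine gaussianSumNorm_comp (fun k i => if j k = i then 1 else 0) (fun k l => ?_) _
    simp [hj.eq_iff, eq_comm]
  rw [← h1]
  refine le_of_eq_of_le ?_ (gaussianSumNorm_ite_le (fun i => ∃ k, j k = i) x)
  congr 1
  ext i
  by_cases hi : ∃ k, j k = i
  · obtain ⟨k, rfl⟩ := hi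
    simp [hj.eq_iff]
  · rw [if_neg hi]
    push Not at hi
    simp [hi]

theorem gaussianSumNorm_lt_top {ι : Type*} [Fintype ι] (x : ι → X) : gaussianSumNorm x < ∞ := by
  have h : ∀ i, MemLp (fun γ : ι → ℂ => γ i • x i) 2 (Measure.pi fun _ => complexGaussian) :=
    fun i => by
      have h1 : MemLp (fun γ : ι → ℂ => γ i) 2 (Measure.pi fun _ => complexGaussian) :=
        memLp_complexGaussian.comp_measurePreserving (measurePreserving_eval _ i)
      refine MemLp.of_le_mul (c := ‖x i‖) h1
        (by fun_prop : Continuous fun γ : ι → ℂ => γ i • x i).aestronglyMeasurable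
        (Filter.Eventually.of_forall fun γ => ?_)
      rw [norm_smul, mul_comm]
  exact (memLp_finsetSum _ fun i _ => h i).2

theorem gaussianSumNorm_unique {ι : Type*} [Fintype ι] [Unique ι] (x : X) :
    gaussianSumNorm (fun _ : ι => x) =
      ‖x‖ₑ * eLpNorm (fun z : ℂ => z) 2 complexGaussian := by
  have hp := measurePreserving_eval (fun _ : ι => complexGaussian) default
  have h1 : gaussianSumNorm (fun _ : ι => x) =
      eLpNorm (fun z : ℂ => z • x) 2 complexGaussian := by
    rw [gaussianSumNorm, ← eLpNorm_comp_measurePreserving (f := Function.eval (default : ι))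
      (by fun_prop : Continuous fun z : ℂ => z • x).aestronglyMeasurable hp]
    congr 1
    ext γ
    simp
  have h2 : eLpNorm (fun z : ℂ => z • x) 2 complexGaussian =
      eLpNorm ((‖x‖ : ℂ) • fun z : ℂ => z) 2 complexGaussian := by
    refine eLpNorm_congr_norm_ae (Filter.Eventually.of_forall fun z => ?_)
    simp [norm_smul, mul_comm]
  rw [h1, h2, eLpNorm_const_smul]
  congr 1
  rw [← ofReal_norm, ← ofReal_norm, Complex.norm_real, norm_norm]

theorem gaussianSumNorm_conj {ι : Type*} [Fintype ι] (x : ι → X) :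
    eLpNorm (fun γ : ι → ℂ => ∑ i, starRingEnd ℂ (γ i) • x i) 2
      (Measure.pi fun _ => complexGaussian) = gaussianSumNorm x := by
  have h : MeasurePreserving (fun (γ : ι → ℂ) i => starRingEnd ℂ (γ i))
      (Measure.pi fun _ => complexGaussian) (Measure.pi fun _ => complexGaussian) :=
    measurePreserving_pi _ _ fun _ =>
      ⟨Complex.continuous_conj.measurable, map_conj_complexGaussian⟩
  rw [gaussianSumNorm, ← eLpNorm_comp_measurePreserving
    (continuous_gaussianSum x).aestronglyMeasurable h]
  rfl

end GaussianInvariance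

/-! ### Estimates for the `γ`-norm -/

section GammaEstimates

variable {H : Type*} [NormedAddCommGroup H] [InnerProductSpace ℂ H]
  {X : Type*} [NormedAddCommGroup X] [NormedSpace ℂ X]

/-- The real part alone has second moment `1`. The exact value `√2` is never needed. -/
theorem one_le_eLpNorm_complexGaussian : 1 ≤ eLpNorm (fun z : ℂ => z) 2 complexGaussian := by
  have h1 : eLpNorm (fun z : ℂ => z.re) 2 complexGaussian ≤
      eLpNorm (fun z : ℂ => z) 2 complexGaussian :=
    eLpNorm_mono fun z => Complex.abs_re_le_norm z
  refine le_trans ?_ h1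
  have h2 : eLpNorm (fun z : ℂ => z.re) 2 complexGaussian =
      eLpNorm (fun x : ℝ => x) 2 (gaussianReal 0 1) := by
    rw [complexGaussian, eLpNorm_map_measure (by fun_prop) (by fun_prop),
      ← eLpNorm_comp_measurePreserving (g := fun x : ℝ => x) (by fun_prop)
        (measurePreserving_fst (μ := gaussianReal 0 1) (ν := gaussianReal 0 1))]
    congr 1
    ext p
    simp
  rw [h2]
  refine (ENNReal.pow_le_pow_left_iff (n := 2) (by norm_num)).1 ?_
  have hm : MemLp (fun x : ℝ => x) 2 (gaussianReal 0 1) := memLp_id_gaussianReal' 2 (by simp)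
  rw [eLpNorm_two_sq_eq_evariance (by simp), ← ofReal_variance hm,
    show (fun x : ℝ => x) = id from rfl, variance_id_gaussianReal]
  simp

theorem eLpNorm_complexGaussian_lt_top : eLpNorm (fun z : ℂ => z) 2 complexGaussian < ∞ :=
  memLp_complexGaussian.2

/-- An orthonormal family is injective, so reindexing by its image yields one of the finite sets in
the supremum. -/
theorem gaussianSumNorm_le_gammaNorm {ι : Type*} [Fintype ι] {v : ι → H} (hv : Orthonormal ℂ v)
    (T : H →L[ℂ] X) : gaussianSumNorm (fun i => T (v i)) ≤ gammaNorm T := by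
  classical
  let F : Finset H := Finset.univ.image v
  let j : ι → F := fun i => ⟨v i, Finset.mem_image_of_mem v (Finset.mem_univ i)⟩
  have hj : Function.Bijective j := by
    refine ⟨fun a b h => hv.linearIndependent.injective (congrArg Subtype.val h), ?_⟩
    rintro ⟨y, hy⟩
    obtain ⟨i, -, rfl⟩ := Finset.mem_image.1 hy
    exact ⟨i, rfl⟩
  let e : ι ≃ F := Equiv.ofBijective j hj
  have hF : Orthonormal ℂ (fun y : F => (y : H)) := by
    have := hv.comp e.symm e.symm.injective
    convert this using 1
    ext y
    obtain ⟨i, rfl⟩ := e.surjective y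
    simp [e, j]
  exact (gaussianSumNorm_reindex e fun y : F => T y).le.trans
    (le_iSup₂_of_le (f := fun (F : Finset H) (_ : Orthonormal ℂ (fun e : F => (e : H))) =>
      gaussianSumNorm fun e : F => T e) F hF le_rfl)

theorem enorm_apply_le_gammaNorm (T : H →L[ℂ] X) {e : H} (he : ‖e‖ = 1) :
    ‖T e‖ₑ ≤ gammaNorm T := by
  have hv : Orthonormal ℂ fun _ : Unit => e :=
    ⟨fun _ => he, fun i j hij => absurd (Subsingleton.elim i j) hij⟩
  have h := gaussianSumNorm_le_gammaNorm hv T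
  rw [gaussianSumNorm_unique] at h
  exact (le_mul_of_one_le_right' one_le_eLpNorm_complexGaussian).trans h

/-- Each unit vector is a one-element orthonormal system. This makes `γ`-convergence imply operator
convergence, which later identifies abstract extensions with honest compositions. -/
theorem opNorm_le_toReal_gammaNorm {T : H →L[ℂ] X} (hT : gammaNorm T < ∞) :
    ‖T‖ ≤ (gammaNorm T).toReal := by
  refine ContinuousLinearMap.opNorm_le_of_unit_norm ENNReal.toReal_nonneg fun e he => ?_
  have := ENNReal.toReal_mono hT.ne (enorm_apply_le_gammaNorm T he)
  rwa [toReal_enorm] at this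

theorem finiteDimensional_ker_orthogonal {T : H →L[ℂ] X} (hT : FiniteDimensional ℂ T.range) :
    FiniteDimensional ℂ (T.ker)ᗮ := by
  let R : (T.ker)ᗮ →ₗ[ℂ] T.range := (T : H →ₗ[ℂ] X).rangeRestrict ∘ₗ (T.ker)ᗮ.subtype
  refine Module.Finite.of_injective R ?_
  rw [← LinearMap.ker_eq_bot, Submodule.eq_bot_iff]
  rintro ⟨v, hv⟩ h
  have h1 : T v = 0 := congrArg Subtype.val (LinearMap.mem_ker.1 h)
  have h2 : inner ℂ v v = 0 := Submodule.inner_right_of_mem_orthogonal (K := T.ker) h1 hv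
  exact Subtype.ext (inner_self_eq_zero.1 h2)

variable [CompleteSpace H]

/-- A test system `F` can be enlarged to an orthonormal basis of a finite-dimensional space `W`
containing all `fᵢ`, which does not decrease the Gaussian sum. On a full basis of `W` the
coefficient matrix of the `fᵢ` has orthonormal rows, so the sum has exactly the norm of `∑ γᵢ xᵢ`.
-/
theorem gammaNorm_sum_smulRight_le {ι : Type*} [Fintype ι] {f : ι → H} (hf : Orthonormal ℂ f)
    (x : ι → X) :
    gammaNorm (∑ i, (InnerProductSpace.toDual ℂ H (f i)).smulRight (x i)) ≤
      gaussianSumNorm x := by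
  classical
  refine iSup₂_le fun F hF => ?_
  let W : Submodule ℂ H := Submodule.span ℂ (F ∪ Set.range f)
  have hW : FiniteDimensional ℂ W :=
    FiniteDimensional.span_of_finite ℂ (F.finite_toSet.union (Set.finite_range f))
  let g : F → W := fun e => ⟨e, Submodule.subset_span (Or.inl e.2)⟩
  let k : ι → W := fun i => ⟨f i, Submodule.subset_span (Or.inr ⟨i, rfl⟩)⟩
  have hg : Orthonormal ℂ g := by
    refine ⟨fun e => hF.1 e, fun a b hab => hF.2 hab⟩
  obtain ⟨u, b, hu, hb⟩ := hg.toSubtypeRange.exists_orthonormalBasis_extension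
  let y : u → X := fun a => ∑ i, inner ℂ (k i) (a : W) • x i
  have h1 : gaussianSumNorm y = gaussianSumNorm x := by
    refine gaussianSumNorm_comp (fun i (a : u) => inner ℂ (k i) (a : W)) (fun i j => ?_) x
    -- Parseval in `W` turns orthonormality of `f` into orthonormality of the rows.
    have h2 := b.sum_inner_mul_inner (k i) (k j)
    have h3 := orthonormal_iff_ite.1 hf i j
    simp only [hb] at h2
    simp only [inner_conj_symm]
    rw [h2, ← h3]
    rfl
  let j : F → u := fun e => ⟨g e, hu ⟨e, rfl⟩⟩
  have hj : Function.Injective j := fun a b hab =>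
    hg.linearIndependent.injective (congrArg Subtype.val hab)
  refine le_of_eq_of_le ?_ ((gaussianSumNorm_comp_injective_le hj y).trans h1.le)
  unfold gaussianSumNorm
  congr 1
  ext γ
  refine Finset.sum_congr rfl fun e _ => ?_
  simp [y, j, g, k, Submodule.coe_inner]

/-- The one-term case after normalising the Riesz vector of `f`. A bound linear in `‖f‖ ‖x‖` is what
makes the operator attached to a functional on `γ(H;X)` bounded. -/
theorem gammaNorm_smulRight_le (f : StrongDual ℂ H) (x : X) :
    gammaNorm (f.smulRight x) ≤
      ‖f‖ₑ * ‖x‖ₑ * eLpNorm (fun z : ℂ => z) 2 complexGaussian := by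
  let k := (InnerProductSpace.toDual ℂ H).symm f
  have hkf : InnerProductSpace.toDual ℂ H k = f := LinearIsometryEquiv.apply_symm_apply _ _
  rcases eq_or_ne k 0 with hk | hk
  · have : f = 0 := by rw [← hkf, hk, map_zero]
    subst this
    have h0 : (0 : StrongDual ℂ H).smulRight x = 0 := by ext; simp
    rw [h0, gammaNorm_zero]
    simp
  have hk' : (‖k‖ : ℂ) ≠ 0 := by simpa using hk
  have hv : Orthonormal ℂ fun _ : Unit => (‖k‖⁻¹ : ℂ) • k :=
    ⟨fun _ => norm_smul_inv_norm hk, fun i j hij => absurd (Subsingleton.elim i j) hij⟩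
  have h := gammaNorm_sum_smulRight_le hv fun _ => (‖k‖ : ℂ) • x
  have h1 : f.smulRight x = ∑ i : Unit, (InnerProductSpace.toDual ℂ H
      ((‖k‖⁻¹ : ℂ) • k)).smulRight ((‖k‖ : ℂ) • x) := by
    ext v
    simp only [Finset.univ_unique, Finset.sum_singleton, ContinuousLinearMap.smulRight_apply,
      InnerProductSpace.toDual_apply_apply, inner_smul_left, smul_smul]
    congr 1
    rw [← hkf, InnerProductSpace.toDual_apply_apply]
    simp only [map_inv₀, Complex.conj_ofReal]
    field_simp
  rw [h1]
  refine h.trans_eq ?_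
  rw [gaussianSumNorm_unique, enorm_smul]
  congr 2
  rw [← hkf, ← ofReal_norm, ← ofReal_norm, Complex.norm_real, norm_norm,
    (InnerProductSpace.toDual ℂ H).norm_map]

end GammaEstimates

/-! ### Operators of finite rank on a Hilbert space -/

section FiniteRank

variable {H : Type*} [NormedAddCommGroup H] [InnerProductSpace ℂ H] [CompleteSpace H]
  {X : Type*} [NormedAddCommGroup X] [NormedSpace ℂ X]

/-- `T` factors through the orthogonal projection onto `(ker T)ᗮ`, which the basis expands. Any
orthonormal basis works, so it may be chosen to diagonalise a further operator. -/
theorem eq_sum_smulRight_of_orthonormalBasis_ker_orthogonal {T : H →L[ℂ] X} {ι : Type*} [Fintype ι]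
    (b : OrthonormalBasis ι ℂ (T.ker)ᗮ) :
    T = ∑ i, (InnerProductSpace.toDual ℂ H (b i)).smulRight (T (b i)) := by
  have : FiniteDimensional ℂ (T.ker)ᗮ := b.toBasis.finiteDimensional_of_finite
  ext h
  have h1 : h - (T.ker)ᗮ.starProjection h ∈ T.ker := by
    have hc : IsClosed (T.ker : Set H) := T.isClosed_ker
    have := hc.completeSpace_coe
    have h2 := (T.ker)ᗮ.sub_starProjection_mem_orthogonal h
    rwa [Submodule.orthogonal_orthogonal] at h2
  have h2 : T h = T ((T.ker)ᗮ.starProjection h) := by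
    have h3 : T (h - (T.ker)ᗮ.starProjection h) = 0 := LinearMap.mem_ker.1 h1
    rwa [map_sub, sub_eq_zero] at h3
  rw [h2, b.starProjection_eq_sum_rankOne]
  simp

theorem exists_orthonormal_eq_sum_smulRight {T : H →L[ℂ] X} (hT : FiniteDimensional ℂ T.range) :
    ∃ (n : ℕ) (e : Fin n → H), Orthonormal ℂ e ∧
      T = ∑ i, (InnerProductSpace.toDual ℂ H (e i)).smulRight (T (e i)) := by
  have := finiteDimensional_ker_orthogonal hT
  let b := stdOrthonormalBasis ℂ (T.ker)ᗮ
  exact ⟨_, fun i => b i, b.orthonormal.comp_linearIsometry (T.ker)ᗮ.subtypeₗᵢ,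
    eq_sum_smulRight_of_orthonormalBasis_ker_orthogonal b⟩

/-- A singular value decomposition: the images of the orthonormal system are orthogonal. -/
theorem exists_orthonormal_eq_sum_smulRight_orthogonal {Y : Type*} [NormedAddCommGroup Y]
    [InnerProductSpace ℂ Y] [CompleteSpace Y] {T : H →L[ℂ] Y}
    (hT : FiniteDimensional ℂ T.range) :
    ∃ (n : ℕ) (e : Fin n → H), Orthonormal ℂ e ∧
      T = ∑ i, (InnerProductSpace.toDual ℂ H (e i)).smulRight (T (e i)) ∧
      ∀ i j, i ≠ j → inner ℂ (T (e i)) (T (e j)) = 0 := by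
  have := finiteDimensional_ker_orthogonal hT
  let A : (T.ker)ᗮ →L[ℂ] Y := T ∘L (T.ker)ᗮ.subtypeL
  -- The basis consists of eigenvectors of `A*A`, with `A` the restriction of `T` to `(ker T)ᗮ`;
  -- then `⟨A bᵢ, A bⱼ⟩ = λⱼ ⟨bᵢ, bⱼ⟩`.
  have hG : (ContinuousLinearMap.adjoint A ∘L A : (T.ker)ᗮ →ₗ[ℂ] (T.ker)ᗮ).IsSymmetric :=
    (ContinuousLinearMap.isPositive_adjoint_comp_self A).isSymmetric
  let b := hG.eigenvectorBasis rfl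
  refine ⟨_, fun i => b i, b.orthonormal.comp_linearIsometry (T.ker)ᗮ.subtypeₗᵢ,
    eq_sum_smulRight_of_orthonormalBasis_ker_orthogonal b, fun i j hij => ?_⟩
  have h1 : inner ℂ (A (b i)) (A (b j)) = inner ℂ (b i) (ContinuousLinearMap.adjoint A (A (b j))) :=
    (ContinuousLinearMap.adjoint_inner_right A _ _).symm
  have h2 : ContinuousLinearMap.adjoint A (A (b j)) = (hG.eigenvalues rfl j : ℂ) • b j :=
    hG.apply_eigenvectorBasis rfl j
  change inner ℂ (A (b i)) (A (b j)) = 0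
  rw [h1, h2, inner_smul_right, b.orthonormal.2 hij, mul_zero]

end FiniteRank

/-! ### Completeness of the space of nuclear operators -/

section NuclearComplete

variable {E F : Type*} [NormedAddCommGroup E] [NormedSpace ℂ E]
  [NormedAddCommGroup F] [NormedSpace ℂ F]

theorem isNuclearRep_smulRight (g : StrongDual ℂ E) (x : F) :
    IsNuclearRep (g.smulRight x) (Pi.single 0 g) (Pi.single 0 x) ∧
      ∑' n : ℕ, ‖(Pi.single 0 g : ℕ → StrongDual ℂ E) n‖ * ‖(Pi.single 0 x : ℕ → F) n‖ =
        ‖g‖ * ‖x‖ := by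
  have h1 : HasSum (fun n : ℕ => ‖(Pi.single 0 g : ℕ → StrongDual ℂ E) n‖ *
      ‖(Pi.single 0 x : ℕ → F) n‖) (‖g‖ * ‖x‖) := by
    convert hasSum_single (f := fun n : ℕ => ‖(Pi.single 0 g : ℕ → StrongDual ℂ E) n‖ *
      ‖(Pi.single 0 x : ℕ → F) n‖) 0 (fun n hn => by simp [hn]) using 1
    simp
  refine ⟨⟨h1.summable, fun h => ?_⟩, h1.tsum_eq⟩
  convert hasSum_single (f := fun n : ℕ => (Pi.single 0 g : ℕ → StrongDual ℂ E) n h •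
    (Pi.single 0 x : ℕ → F) n) 0 (fun n hn => by simp [hn]) using 1
  simp

theorem isNuclear_smulRight (g : StrongDual ℂ E) (x : F) : IsNuclear (g.smulRight x) :=
  ⟨_, _, (isNuclearRep_smulRight g x).1⟩

theorem nuclearNorm_smulRight_le (g : StrongDual ℂ E) (x : F) :
    nuclearNorm (g.smulRight x) ≤ ‖g‖ * ‖x‖ :=
  (isNuclearRep_smulRight g x).1.nuclearNorm_le.trans_eq (isNuclearRep_smulRight g x).2

variable (E F) in
/-- The inclusion of the nuclear operators into the bounded operators. -/
noncomputable def NuclearOp.toCLMₗ : NuclearOp E F →ₗ[ℂ] (E →L[ℂ] F) :=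
  (nuclearSubmodule E F).subtype

theorem NuclearOp.continuous_toCLM : Continuous (NuclearOp.toCLM : NuclearOp E F → (E →L[ℂ] F)) :=
  ((NuclearOp.toCLMₗ E F).mkContinuous 1 fun T => by
    rw [one_mul]; exact T.isNuclear.norm_le).continuous

theorem nuclearNorm_sum_smulRight_le {ι : Type*} (s : Finset ι) (g : ι → StrongDual ℂ E)
    (x : ι → F) : nuclearNorm (∑ i ∈ s, (g i).smulRight (x i)) ≤ ∑ i ∈ s, ‖g i‖ * ‖x i‖ := by
  let T : ι → NuclearOp E F := fun i => ⟨(g i).smulRight (x i), isNuclear_smulRight _ _⟩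
  have h1 : (∑ i ∈ s, T i).toCLM = ∑ i ∈ s, (g i).smulRight (x i) :=
    map_sum (NuclearOp.toCLMₗ E F) T s
  rw [← h1]
  exact (norm_sum_le s T).trans (Finset.sum_le_sum fun i _ => nuclearNorm_smulRight_le _ _)

/-- Near-optimal representations of the `S k` are concatenated into one double series, enumerated
along `ℕ ≃ ℕ × ℕ`. -/
theorem IsNuclear.of_hasSum [CompleteSpace F] {T : E →L[ℂ] F} {S : ℕ → E →L[ℂ] F}
    (hS : ∀ k, IsNuclear (S k)) (hs : Summable fun k => nuclearNorm (S k))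
    (hT : ∀ h, HasSum (fun k => S k h) (T h)) :
    IsNuclear T ∧ nuclearNorm T ≤ ∑' k, nuclearNorm (S k) := by
  have key : ∀ ε : ℝ, 0 < ε → ∃ g x, IsNuclearRep T g x ∧
      ∑' n, ‖g n‖ * ‖x n‖ ≤ ∑' k, nuclearNorm (S k) + ε := by
    intro ε hε
    -- The errors `ε / 2 / 2 ^ k`, `k ≥ 0`, add up to `ε`.
    choose g x hgx hlt using fun k => (hS k).exists_lt
      (r := nuclearNorm (S k) + ε / 2 / 2 ^ k) (lt_add_of_pos_right _ (by positivity))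
    have hsum : HasSum (fun k => nuclearNorm (S k) + ε / 2 / 2 ^ k)
        (∑' k, nuclearNorm (S k) + ε) := hs.hasSum.add (hasSum_geometric_two' ε)
    let a : ℕ × ℕ → ℝ := fun p => ‖g p.1 p.2‖ * ‖x p.1 p.2‖
    have ha0 : ∀ p, 0 ≤ a p := fun p => by positivity
    have hle : Summable fun k => ∑' n, a (k, n) :=
      Summable.of_nonneg_of_le (fun k => tsum_nonneg fun n => ha0 _) (fun k => (hlt k).le)
        hsum.summable
    have ha : Summable a := (summable_prod_of_nonneg ha0).2 ⟨fun k => (hgx k).1, hle⟩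
    let e : ℕ ≃ ℕ × ℕ := Nat.pairEquiv.symm
    refine ⟨fun n => g (e n).1 (e n).2, fun n => x (e n).1 (e n).2,
      ⟨(e.summable_iff (f := a)).2 ha, fun h => ?_⟩, ?_⟩
    · have hb : Summable fun p : ℕ × ℕ => g p.1 p.2 h • x p.1 p.2 := by
        refine Summable.of_norm_bounded (ha.mul_right ‖h‖) fun p => ?_
        rw [norm_smul]
        simp only [a]
        nlinarith [(g p.1 p.2).le_opNorm h, norm_nonneg (x p.1 p.2)]
      have h1 := hb.hasSum.prod_fiberwise fun k => (hgx k).2 h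
      have h2 := hb.hasSum
      rw [h1.unique (hT h)] at h2
      exact (e.hasSum_iff (f := fun p : ℕ × ℕ => g p.1 p.2 h • x p.1 p.2)).2 h2
    · calc ∑' n, ‖g (e n).1 (e n).2‖ * ‖x (e n).1 (e n).2‖ = ∑' p, a p := e.tsum_eq a
        _ = ∑' k, ∑' n, a (k, n) := ha.tsum_prod
        _ ≤ ∑' k, nuclearNorm (S k) + ε := by
          rw [← hsum.tsum_eq]
          exact hle.tsum_le_tsum (fun k => (hlt k).le) hsum.summable
  obtain ⟨g, x, h, -⟩ := key 1 one_pos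
  refine ⟨⟨g, x, h⟩, le_of_forall_pos_le_add fun ε hε => ?_⟩
  obtain ⟨g, x, h, hle⟩ := key ε hε
  exact h.nuclearNorm_le.trans hle

instance [CompleteSpace F] : CompleteSpace (NuclearOp E F) := by
  refine NormedAddCommGroup.completeSpace_of_summable_imp_tendsto fun u hu => ?_
  have hs : Summable fun k => (u k).toCLM :=
    Summable.of_norm_bounded hu fun k => (u k).isNuclear.norm_le
  have hpt : ∀ h, HasSum (fun k => (u k).toCLM h) ((∑' k, (u k).toCLM) h) := fun h =>
    hs.hasSum.mapL (ContinuousLinearMap.apply ℂ F h)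
  have hT := IsNuclear.of_hasSum (fun k => (u k).isNuclear) hu hpt
  let T : NuclearOp E F := ⟨∑' k, (u k).toCLM, hT.1⟩
  refine ⟨T, ?_⟩
  rw [tendsto_iff_norm_sub_tendsto_zero]
  refine squeeze_zero (fun n => norm_nonneg _) (fun n => ?_)
    (tendsto_sum_nat_add fun k => ‖u k‖)
  rw [norm_sub_rev]
  -- The remainder is represented by the tail of the series, so its nuclear norm is at most the tail
  -- sum of the norms.
  refine (IsNuclear.of_hasSum (T := (T - ∑ i ∈ Finset.range n, u i).toCLM)
    (S := fun k => (u (k + n)).toCLM) (fun k => (u (k + n)).isNuclear)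
    ((summable_nat_add_iff n).2 hu) fun h => ?_).2
  have h1 : (T - ∑ i ∈ Finset.range n, u i).toCLM =
      T.toCLM - ∑ i ∈ Finset.range n, (u i).toCLM :=
    (map_sub (NuclearOp.toCLMₗ E F) T _).trans
      (congrArg (T.toCLM - ·) (map_sum (NuclearOp.toCLMₗ E F) u _))
  rw [h1]
  have h2 := (hasSum_nat_add_iff' n).2 (hpt h)
  simpa [T, NuclearOp.toCLM] using h2

end NuclearComplete

/-! ### Continuity of the trace in the nuclear norm -/

section NuclearTrace

variable {H : Type*} [NormedAddCommGroup H] [InnerProductSpace ℂ H] [CompleteSpace H]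

theorem IsNuclear.norm_nuclearTrace_le {T : H →L[ℂ] H} (hT : IsNuclear T) :
    ‖nuclearTrace T‖ ≤ nuclearNorm T := by
  refine le_of_forall_pos_le_add fun ε hε => ?_
  obtain ⟨g, x, h, hlt⟩ := hT.exists_lt (r := nuclearNorm T + ε) (by linarith)
  rw [h.nuclearTrace_eq]
  refine (tsum_of_norm_bounded h.1.hasSum fun n => (g n).le_opNorm (x n)).trans hlt.le

variable (H) in
/-- The trace as a bounded linear functional on the nuclear operators. -/
noncomputable def nuclearTraceCLM : NuclearOp H H →L[ℂ] ℂ :=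
  LinearMap.mkContinuous
    { toFun := fun T => nuclearTrace T.toCLM
      map_add' := fun S T => S.isNuclear.nuclearTrace_add T.isNuclear
      map_smul' := fun c T => T.isNuclear.nuclearTrace_smul c } 1
    fun T => by rw [one_mul]; exact T.isNuclear.norm_nuclearTrace_le

theorem nuclearTraceCLM_apply (T : NuclearOp H H) :
    nuclearTraceCLM H T = nuclearTrace T.toCLM := rfl

end NuclearTrace

/-! ### Inclusions of operator spaces -/

section Inclusions

variable {H : Type*} [NormedAddCommGroup H] [InnerProductSpace ℂ H]
  {X : Type*} [NormedAddCommGroup X] [NormedSpace ℂ X]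

theorem finiteDimensional_range_smulRight (f : StrongDual ℂ H) (x : X) :
    FiniteDimensional ℂ (f.smulRight x).range := by
  refine Submodule.finiteDimensional_of_le (S₂ := ℂ ∙ x) ?_
  rintro _ ⟨v, rfl⟩
  exact Submodule.mem_span_singleton.2 ⟨f v, rfl⟩

theorem finiteDimensional_range_sum_smulRight {ι : Type*} (s : Finset ι) (f : ι → StrongDual ℂ H)
    (x : ι → X) : FiniteDimensional ℂ (∑ i ∈ s, (f i).smulRight (x i)).range := by
  classical
  refine Submodule.finiteDimensional_of_le (S₂ := Submodule.span ℂ (s.image x : Set X)) ?_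
  rintro _ ⟨v, rfl⟩
  have h : (∑ i ∈ s, (f i).smulRight (x i)) v = ∑ i ∈ s, f i v • x i := by simp
  change (∑ i ∈ s, (f i).smulRight (x i)) v ∈ _
  rw [h]
  exact Submodule.sum_mem _ fun i hi => Submodule.smul_mem _ _
    (Submodule.subset_span (Finset.mem_coe.2 (Finset.mem_image_of_mem x hi)))

variable (H X) in
/-- The inclusion of the finite rank operators into `γ(H;X)`. -/
noncomputable def finiteRankInclusion : finiteRankGamma H X →ₗ[ℂ] GammaRad H X :=
  Submodule.inclusion (finiteRankGamma H X).le_topologicalClosure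

theorem denseRange_finiteRankInclusion : DenseRange (finiteRankInclusion H X) := by
  have := denseRange_inclusion_iff (s := (finiteRankGamma H X : Set (GammaSumming H X)))
    (t := ((finiteRankGamma H X).topologicalClosure : Set (GammaSumming H X)))
    (finiteRankGamma H X).le_topologicalClosure
  exact this.2 (Submodule.topologicalClosure_coe _).le

theorem GammaRad.norm_def (U : GammaRad H X) : ‖U‖ = (gammaNorm U.toCLM).toReal := rfl

variable (H X) in
/-- The inclusion of `γ(H;X)` into the bounded operators. -/
noncomputable def GammaRad.toCLMₗ : GammaRad H X →ₗ[ℂ] (H →L[ℂ] X) :=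
  (gammaSummingSubmodule H X).subtype ∘ₗ (finiteRankGamma H X).topologicalClosure.subtype

theorem GammaRad.continuous_toCLM : Continuous (GammaRad.toCLM : GammaRad H X → (H →L[ℂ] X)) :=
  ((GammaRad.toCLMₗ H X).mkContinuous 1 fun U => by
    rw [one_mul]
    exact opNorm_le_toReal_gammaNorm (GammaSumming.gammaNorm_lt_top U.1)).continuous

theorem GammaRad.toCLM_injective :
    Function.Injective (GammaRad.toCLM : GammaRad H X → (H →L[ℂ] X)) :=
  fun _ _ h => Subtype.ext (Subtype.ext h)

end Inclusions

/-! ### Trace duality for operators of finite rank -/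

section FiniteRankDuality

variable {H : Type*} [NormedAddCommGroup H] [InnerProductSpace ℂ H] [CompleteSpace H]
  {X : Type*} [NormedAddCommGroup X] [NormedSpace ℂ X]

theorem gammaNorm_lt_top_of_finiteDimensional_range {T : H →L[ℂ] X}
    (hT : FiniteDimensional ℂ T.range) : gammaNorm T < ∞ := by
  obtain ⟨n, e, he, h⟩ := exists_orthonormal_eq_sum_smulRight hT
  rw [h]
  exact (gammaNorm_sum_smulRight_le he _).trans_lt (gaussianSumNorm_lt_top _)

/-- The operator `V' : X ⊆ X'' → H'' = H`. -/
noncomputable def dualRestrict (V : StrongDual ℂ H →L[ℂ] StrongDual ℂ X) : X →L[ℂ] H :=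
  ((hilbertBidual H).symm.toContinuousLinearEquiv :
      StrongDual ℂ (StrongDual ℂ H) →L[ℂ] H) ∘L
    (ContinuousLinearMap.precomp ℂ V :
      StrongDual ℂ (StrongDual ℂ X) →L[ℂ] StrongDual ℂ (StrongDual ℂ H)) ∘L
    NormedSpace.inclusionInDoubleDual ℂ X

theorem dualComp_eq_comp (V : StrongDual ℂ H →L[ℂ] StrongDual ℂ X) (U : H →L[ℂ] X) :
    dualComp V U = dualRestrict V ∘L U := rfl

theorem nuclearTrace_dualComp_sum_smulRight (V : StrongDual ℂ H →L[ℂ] StrongDual ℂ X)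
    {ι : Type*} (s : Finset ι) (f : ι → StrongDual ℂ H) (x : ι → X) :
    nuclearTrace (dualComp V (∑ i ∈ s, (f i).smulRight (x i))) = ∑ i ∈ s, V (f i) (x i) := by
  have hn : ∀ i, IsNuclear (dualComp V ((f i).smulRight (x i))) := fun i =>
    isNuclear_dualComp V (finiteDimensional_range_smulRight (f i) (x i))
  let T : ι → NuclearOp H H := fun i => ⟨_, hn i⟩
  have h1 : (∑ i ∈ s, T i).toCLM = dualComp V (∑ i ∈ s, (f i).smulRight (x i)) := by
    rw [dualComp_eq_comp, ContinuousLinearMap.comp_finsetSum]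
    exact map_sum (NuclearOp.toCLMₗ H H) T s
  rw [← h1, ← nuclearTraceCLM_apply, map_sum]
  exact Finset.sum_congr rfl fun i _ => nuclearTrace_dualComp_rankOne V (f i) (x i)

/-- Homogeneity extends the defining supremum from the unit ball to every `U` of finite rank. When
`‖U‖_γ = 0` there is nothing to normalise, but then `U = 0`. -/
theorem norm_nuclearTrace_dualComp_le {V : StrongDual ℂ H →L[ℂ] StrongDual ℂ X}
    (hV : gammaDualNorm V < ∞) {U : H →L[ℂ] X} (hU : FiniteDimensional ℂ U.range) :
    ‖nuclearTrace (dualComp V U)‖ ≤ (gammaDualNorm V).toReal * (gammaNorm U).toReal := by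
  have hfin := gammaNorm_lt_top_of_finiteDimensional_range hU
  rcases eq_or_ne (gammaNorm U) 0 with h0 | h0
  · have := eq_zero_of_gammaNorm_eq_zero h0
    subst this
    have h1 : dualComp V (0 : H →L[ℂ] X) = 0 := by rw [dualComp_eq_comp]; simp
    rw [h1]
    refine (IsNuclear.zero.norm_nuclearTrace_le).trans ?_
    have := (nuclearNorm_sum_smulRight_le (E := H) (F := H) (∅ : Finset ℕ) 0 0)
    simp only [Finset.sum_empty] at this
    exact this.trans (by positivity)
  · let c : ℝ := (gammaNorm U).toReal
    have hc : 0 < c := ENNReal.toReal_pos h0 hfin.ne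
    have hle : gammaNorm ((c⁻¹ : ℂ) • U) ≤ 1 := by
      rw [gammaNorm_smul, ← ENNReal.ofReal_toReal hfin.ne, ← ofReal_norm,
        ← ENNReal.ofReal_mul (norm_nonneg _), ENNReal.ofReal_le_one, norm_inv, Complex.norm_real,
        Real.norm_of_nonneg hc.le, inv_mul_cancel₀ hc.ne']
    have h1 : ‖nuclearTrace (dualComp V ((c⁻¹ : ℂ) • U))‖ₑ ≤ gammaDualNorm V :=
      le_iSup₂_of_le (f := fun (U : H →L[ℂ] X) (_ : gammaNorm U ≤ 1 ∧
        FiniteDimensional ℂ U.range) => ‖nuclearTrace (dualComp V U)‖ₑ) ((c⁻¹ : ℂ) • U)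
        ⟨hle, finiteDimensional_range_smul _ hU⟩ le_rfl
    have h2 := ENNReal.toReal_mono hV.ne h1
    rw [toReal_enorm, dualComp_smul_right, (isNuclear_dualComp V hU).nuclearTrace_smul, norm_mul,
      norm_inv, Complex.norm_real, Real.norm_of_nonneg hc.le, inv_mul_le_iff₀ hc] at h2
    rwa [mul_comm]

/-- The norm of `V` only controls traces. The nuclear norm of `V'U` is reached by composing `U` with
a partial isometry that aligns the singular vectors, so that the trace becomes the sum of the
singular values. -/
theorem nuclearNorm_dualComp_le_of_finiteDimensional_range
    {V : StrongDual ℂ H →L[ℂ] StrongDual ℂ X}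
    (hV : gammaDualNorm V < ∞) {U : H →L[ℂ] X} (hU : FiniteDimensional ℂ U.range) :
    nuclearNorm (dualComp V U) ≤ (gammaDualNorm V).toReal * (gammaNorm U).toReal := by
  classical
  have hT : FiniteDimensional ℂ (dualComp V U).range := by
    refine Submodule.finiteDimensional_of_le (S₂ := U.range.map (dualRestrict V : X →ₗ[ℂ] H)) ?_
    rintro _ ⟨v, rfl⟩
    exact ⟨U v, ⟨v, rfl⟩, rfl⟩
  obtain ⟨n, w, hw, hsum, horth⟩ := exists_orthonormal_eq_sum_smulRight_orthogonal hT
  let T := dualComp V U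
  -- Zero singular values are discarded so that the `T wᵢ` can be normalised.
  let s : Finset (Fin n) := Finset.univ.filter fun i => T (w i) ≠ 0
  let f : s → H := fun i => (‖T (w i)‖⁻¹ : ℂ) • T (w i)
  have hs : ∀ i : s, T (w i) ≠ 0 := fun i => (Finset.mem_filter.1 i.2).2
  have hf : Orthonormal ℂ f := by
    refine ⟨fun i => norm_smul_inv_norm (hs i), fun i j hij => ?_⟩
    simp only [f]
    rw [inner_smul_left, inner_smul_right, horth i j fun h => hij (Subtype.ext h)]
    simp
  have hfT : ∀ i : s, inner ℂ (f i) (T (w i)) = (‖T (w i)‖ : ℂ) := by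
    intro i
    have h0 : (‖T (w i)‖ : ℂ) ≠ 0 := by simpa using hs i
    simp only [f]
    rw [inner_smul_left, inner_self_eq_norm_sq_to_K]
    simp only [map_inv₀, Complex.conj_ofReal, Complex.coe_algebraMap]
    field_simp
  -- `S = U ∘ J`, where the partial isometry `J` maps `fᵢ` to `wᵢ` and vanishes on the orthogonal
  -- complement of the `fᵢ`.
  let S : H →L[ℂ] X := ∑ i : s, (InnerProductSpace.toDual ℂ H (f i)).smulRight (U (w i))
  have hS : gammaNorm S ≤ gammaNorm U :=
    (gammaNorm_sum_smulRight_le hf fun i : s => U (w i)).trans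
      (gaussianSumNorm_le_gammaNorm (hw.comp _ Subtype.val_injective) U)
  have htr : nuclearTrace (dualComp V S) = ((∑ i, ‖T (w i)‖ : ℝ) : ℂ) := by
    rw [nuclearTrace_dualComp_sum_smulRight]
    have h1 : ∀ i : s, V (InnerProductSpace.toDual ℂ H (f i)) (U (w i)) = (‖T (w i)‖ : ℂ) :=
      fun i => by rw [← apply_dualComp, InnerProductSpace.toDual_apply_apply]; exact hfT i
    simp only [h1]
    rw [Finset.sum_coe_sort s fun i => (‖T (w i)‖ : ℂ), Complex.ofReal_sum]
    refine Finset.sum_subset (Finset.subset_univ s) fun i _ hi => ?_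
    have : T (w i) = 0 := by
      by_contra h
      exact hi (Finset.mem_filter.2 ⟨Finset.mem_univ i, h⟩)
    simp [this]
  have hnuc : nuclearNorm T ≤ ∑ i, ‖T (w i)‖ := by
    have h1 : T = ∑ i, (InnerProductSpace.toDual ℂ H (w i)).smulRight (T (w i)) := hsum
    rw [h1]
    refine (nuclearNorm_sum_smulRight_le _ _ _).trans_eq (Finset.sum_congr rfl fun i _ => ?_)
    rw [← h1, (InnerProductSpace.toDual ℂ H).norm_map, hw.1, one_mul]
  have h2 := norm_nuclearTrace_dualComp_le hV (U := S)
    (finiteDimensional_range_sum_smulRight _ _ _)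
  rw [htr, Complex.norm_real, Real.norm_of_nonneg (by positivity)] at h2
  exact hnuc.trans (h2.trans (mul_le_mul_of_nonneg_left
    (ENNReal.toReal_mono (gammaNorm_lt_top_of_finiteDimensional_range hU).ne hS)
    ENNReal.toReal_nonneg))

theorem gammaDualNorm_le_of_forall {V : StrongDual ℂ H →L[ℂ] StrongDual ℂ X} {C : ℝ}
    (hC : 0 ≤ C) (h : ∀ U : H →L[ℂ] X, FiniteDimensional ℂ U.range →
      ‖nuclearTrace (dualComp V U)‖ ≤ C * (gammaNorm U).toReal) :
    gammaDualNorm V ≤ ENNReal.ofReal C := by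
  refine iSup₂_le fun U hU => ?_
  rw [← ofReal_norm]
  refine ENNReal.ofReal_le_ofReal ((h U hU.2).trans (mul_le_of_le_one_right hC ?_))
  exact ENNReal.toReal_le_of_le_ofReal zero_le_one (by simpa using hU.1)

end FiniteRankDuality

/-! ### Trace duality for `γ`-radonifying operators -/

section GammaDuality

variable {H : Type*} [NormedAddCommGroup H] [InnerProductSpace ℂ H] [CompleteSpace H]
  {X : Type*} [NormedAddCommGroup X] [NormedSpace ℂ X]

/-- The element of the space of finite rank operators given by an operator of finite rank. -/
noncomputable def finiteRankMk (U : H →L[ℂ] X) (hU : FiniteDimensional ℂ U.range) :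
    finiteRankGamma H X :=
  ⟨⟨U, gammaNorm_lt_top_of_finiteDimensional_range hU⟩, hU⟩

/-- The map `U ↦ V'U` on operators of finite rank. -/
noncomputable def finiteRankDualComp (V : GammaDual H X) :
    finiteRankGamma H X →ₗ[ℂ] NuclearOp H H where
  toFun U := ⟨dualComp V.toCLM U.1.toCLM, isNuclear_dualComp V.toCLM U.2⟩
  map_add' _ _ := Subtype.ext (ContinuousLinearMap.comp_add (dualRestrict V.toCLM) _ _)
  map_smul' c _ := Subtype.ext (dualComp_smul_right c V.toCLM _)

theorem norm_finiteRankDualComp_le (V : GammaDual H X) (U : finiteRankGamma H X) :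
    ‖finiteRankDualComp V U‖ ≤ ‖V‖ * ‖finiteRankInclusion H X U‖ :=
  nuclearNorm_dualComp_le_of_finiteDimensional_range V.gammaDualNorm_lt_top U.2

/-- The map `γ(H;X) → Nuc(H)`, `U ↦ V'U`. -/
noncomputable def gammaDualComp (V : GammaDual H X) : GammaRad H X →L[ℂ] NuclearOp H H :=
  (finiteRankDualComp V).extendOfNorm (finiteRankInclusion H X)

theorem norm_gammaDualComp_le (V : GammaDual H X) : ‖gammaDualComp V‖ ≤ ‖V‖ :=
  LinearMap.opNorm_extendOfNorm_le denseRange_finiteRankInclusion (norm_nonneg V)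
    (norm_finiteRankDualComp_le V)

/-- The left side is only an extension by density. Both sides are continuous into the bounded
operators with the operator norm and agree on finite rank operators. -/
theorem toCLM_gammaDualComp (V : GammaDual H X) (U : GammaRad H X) :
    (gammaDualComp V U).toCLM = dualComp V.toCLM U.toCLM := by
  have h1 : Continuous fun U : GammaRad H X => (gammaDualComp V U).toCLM :=
    NuclearOp.continuous_toCLM.comp (gammaDualComp V).continuous
  have h2 : Continuous fun U : GammaRad H X => dualRestrict V.toCLM ∘L U.toCLM :=
    continuous_const.clm_comp GammaRad.continuous_toCLM
  refine congrFun (denseRange_finiteRankInclusion.equalizer h1 h2 (funext fun U => ?_)) U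
  have h3 : gammaDualComp V (finiteRankInclusion H X U) = finiteRankDualComp V U :=
    LinearMap.extendOfNorm_eq denseRange_finiteRankInclusion
      ⟨_, norm_finiteRankDualComp_le V⟩ U
  exact congrArg NuclearOp.toCLM h3

/-- The supremum defining `‖V‖` only tests finite rank operators, and these lie in `γ(H;X)`. This
supplies the lower bound in both isometries. -/
theorem norm_le_of_forall_nuclearTrace {V : GammaDual H X} {C : ℝ} (hC : 0 ≤ C)
    (h : ∀ U : GammaRad H X, ‖nuclearTrace (dualComp V.toCLM U.toCLM)‖ ≤ C * ‖U‖) : ‖V‖ ≤ C :=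
  ENNReal.toReal_le_of_le_ofReal hC (gammaDualNorm_le_of_forall hC fun U hU =>
    h (finiteRankInclusion H X (finiteRankMk U hU)))

variable (H X) in
/-- The linear isometry `γ'(H';X') → L(γ(H;X); Nuc(H))`, `V ↦ (U ↦ V'U)`. -/
noncomputable def gammaDualCompLI :
    GammaDual H X →ₗᵢ[ℂ] (GammaRad H X →L[ℂ] NuclearOp H H) where
  toFun := gammaDualComp
  map_add' V W := by
    ext1 U
    refine Subtype.ext ?_
    change (gammaDualComp (V + W) U).toCLM =
      (gammaDualComp V U).toCLM + (gammaDualComp W U).toCLM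
    simp only [toCLM_gammaDualComp]
    exact dualComp_add V.toCLM W.toCLM U.toCLM
  map_smul' c V := by
    ext1 U
    refine Subtype.ext ?_
    change (gammaDualComp (c • V) U).toCLM = c • (gammaDualComp V U).toCLM
    simp only [toCLM_gammaDualComp]
    exact dualComp_smul c V.toCLM U.toCLM
  norm_map' V := by
    refine le_antisymm (norm_gammaDualComp_le V)
      (norm_le_of_forall_nuclearTrace (norm_nonneg _) fun U => ?_)
    rw [← toCLM_gammaDualComp]
    exact (gammaDualComp V U).isNuclear.norm_nuclearTrace_le.trans ((gammaDualComp V).le_opNorm U)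

variable (H X) in
/-- The linear isometry `γ'(H';X') → γ(H;X)'`, `V ↦ (U ↦ tr(V'U))`. -/
noncomputable def gammaTraceDuality : GammaDual H X →ₗᵢ[ℂ] StrongDual ℂ (GammaRad H X) where
  toFun V := nuclearTraceCLM H ∘L gammaDualComp V
  map_add' V W := (congrArg (nuclearTraceCLM H ∘L ·) ((gammaDualCompLI H X).map_add V W)).trans
    (ContinuousLinearMap.comp_add _ _ _)
  map_smul' c V := (congrArg (nuclearTraceCLM H ∘L ·) ((gammaDualCompLI H X).map_smul c V)).trans
    (ContinuousLinearMap.comp_smul _ _ _)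
  norm_map' V := by
    refine le_antisymm ?_ ?_
    · refine ContinuousLinearMap.opNorm_le_bound _ (norm_nonneg V) fun U => ?_
      exact (gammaDualComp V U).isNuclear.norm_nuclearTrace_le.trans
        ((gammaDualComp V).le_of_opNorm_le (norm_gammaDualComp_le V) U)
    · refine norm_le_of_forall_nuclearTrace (norm_nonneg _) fun U => ?_
      rw [← toCLM_gammaDualComp]
      exact ContinuousLinearMap.le_opNorm (nuclearTraceCLM H ∘L gammaDualComp V) U

theorem gammaTraceDuality_apply (V : GammaDual H X) (U : GammaRad H X) :
    gammaTraceDuality H X V U = nuclearTrace (dualComp V.toCLM U.toCLM) := by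
  rw [← toCLM_gammaDualComp]
  rfl

/-- The rank one operator `f ⊗ x` as an element of `γ(H;X)`. -/
noncomputable def rankOneGamma (f : StrongDual ℂ H) (x : X) : GammaRad H X :=
  finiteRankInclusion H X (finiteRankMk (f.smulRight x)
    (finiteDimensional_range_smulRight f x))

theorem toCLM_rankOneGamma (f : StrongDual ℂ H) (x : X) :
    (rankOneGamma f x).toCLM = f.smulRight x := rfl

theorem norm_rankOneGamma_le (f : StrongDual ℂ H) (x : X) :
    ‖rankOneGamma f x‖ ≤ (eLpNorm (fun z : ℂ => z) 2 complexGaussian).toReal * ‖f‖ * ‖x‖ := by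
  have hfin : ‖f‖ₑ * ‖x‖ₑ * eLpNorm (fun z : ℂ => z) 2 complexGaussian ≠ ∞ :=
    (ENNReal.mul_lt_top (ENNReal.mul_lt_top enorm_lt_top enorm_lt_top)
      eLpNorm_complexGaussian_lt_top).ne
  have h := ENNReal.toReal_mono hfin (gammaNorm_smulRight_le f x)
  rw [ENNReal.toReal_mul, ENNReal.toReal_mul, toReal_enorm, toReal_enorm] at h
  rw [GammaRad.norm_def, toCLM_rankOneGamma]
  linarith

/-- The operator `V : H' → X'` with `⟨x, V f⟩ = φ(f ⊗ x)`. -/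
noncomputable def functionalOperator (φ : StrongDual ℂ (GammaRad H X)) :
    StrongDual ℂ H →L[ℂ] StrongDual ℂ X :=
  LinearMap.mkContinuous₂
    (LinearMap.mk₂ ℂ (fun f x => φ (rankOneGamma f x))
      (fun f g x => by
        rw [← map_add]
        congr 1
        refine GammaRad.toCLM_injective (ContinuousLinearMap.ext fun v => ?_)
        exact add_smul (f v) (g v) x)
      (fun c f x => by
        rw [← map_smul]
        congr 1
        refine GammaRad.toCLM_injective (ContinuousLinearMap.ext fun v => ?_)
        exact smul_assoc c (f v) x)
      (fun f x y => by
        rw [← map_add]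
        congr 1
        refine GammaRad.toCLM_injective (ContinuousLinearMap.ext fun v => ?_)
        exact smul_add (f v) x y)
      (fun c f x => by
        rw [← map_smul]
        congr 1
        refine GammaRad.toCLM_injective (ContinuousLinearMap.ext fun v => ?_)
        exact smul_comm (f v) c x))
    -- The constant comes from the bound on `‖f ⊗ x‖_γ`.
    (‖φ‖ * (eLpNorm (fun z : ℂ => z) 2 complexGaussian).toReal)
    (fun f x => by
      refine (φ.le_opNorm _).trans ?_
      have := mul_le_mul_of_nonneg_left (norm_rankOneGamma_le f x) (norm_nonneg φ)
      linarith)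

/-- Both sides are linear in `U` and agree on rank one operators by the choice of the operator; `U`
is a finite sum of these. -/
theorem nuclearTrace_dualComp_functionalOperator (φ : StrongDual ℂ (GammaRad H X))
    (U : finiteRankGamma H X) :
    nuclearTrace (dualComp (functionalOperator φ) (finiteRankInclusion H X U).toCLM) =
      φ (finiteRankInclusion H X U) := by
  obtain ⟨n, e, -, h⟩ := exists_orthonormal_eq_sum_smulRight U.2
  have h1 : finiteRankInclusion H X U =
      ∑ i, rankOneGamma (InnerProductSpace.toDual ℂ H (e i)) (U.1.toCLM (e i)) := by
    refine GammaRad.toCLM_injective (h.trans ?_)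
    exact (map_sum (GammaRad.toCLMₗ H X) (fun i =>
      rankOneGamma (InnerProductSpace.toDual ℂ H (e i)) (U.1.toCLM (e i))) Finset.univ).symm
  have h2 : (finiteRankInclusion H X U).toCLM =
      ∑ i, (InnerProductSpace.toDual ℂ H (e i)).smulRight (U.1.toCLM (e i)) := h
  rw [h2, nuclearTrace_dualComp_sum_smulRight, h1, map_sum]
  rfl

theorem gammaTraceDuality_surjective : Function.Surjective (gammaTraceDuality H X) := by
  intro φ
  have hle : gammaDualNorm (functionalOperator φ) ≤ ENNReal.ofReal ‖φ‖ := by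
    refine gammaDualNorm_le_of_forall (norm_nonneg φ) fun U hU => ?_
    have h1 := nuclearTrace_dualComp_functionalOperator φ (finiteRankMk U hU)
    have h2 : ‖nuclearTrace (dualComp (functionalOperator φ) U)‖ =
      ‖φ (finiteRankInclusion H X (finiteRankMk U hU))‖ := congrArg norm h1
    rw [h2]
    exact φ.le_opNorm _
  let V : GammaDual H X := ⟨functionalOperator φ, hle.trans_lt ENNReal.ofReal_lt_top⟩
  refine ⟨V, ContinuousLinearMap.ext fun U => ?_⟩
  refine congrFun (denseRange_finiteRankInclusion.equalizer (gammaTraceDuality H X V).continuous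
    φ.continuous (funext fun U => ?_)) U
  exact (gammaTraceDuality_apply V _).trans (nuclearTrace_dualComp_functionalOperator φ U)

end GammaDuality

/-! ### The `γ`-norm dominates the trace dual norm -/

section GammaNormDual

theorem integral_mul_conj_pi_complexGaussian {ι : Type*} [Fintype ι] [DecidableEq ι] (i j : ι) :
    ∫ γ : ι → ℂ, γ i * starRingEnd ℂ (γ j) ∂(Measure.pi fun _ => complexGaussian) =
      if i = j then ((∫ z, ‖z‖ ^ 2 ∂complexGaussian : ℝ) : ℂ) else 0 := by
  split_ifs with h
  · subst h
    have h1 := integral_comp_eval (μ := fun _ : ι => complexGaussian) (i := i)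
      (f := fun z : ℂ => ((‖z‖ ^ 2 : ℝ) : ℂ)) (by fun_prop)
    rw [← integral_complex_ofReal, ← h1]
    refine integral_congr_ae (Filter.Eventually.of_forall fun γ => ?_)
    simp only [Complex.mul_conj, Complex.sq_norm]
  -- Flipping the sign of `γ i` preserves the law and negates the integrand, since `j ≠ i`; hence
  -- the integral vanishes.
  · let C : ι → ι → ℂ := fun k l => if k = l then (if k = i then -1 else 1) else 0
    have hC : ∀ k l, ∑ m, C k m * starRingEnd ℂ (C l m) = if k = l then 1 else 0 := by
      intro k l
      by_cases hkl : k = l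
      · subst hkl
        by_cases hk : k = i <;> simp [C, hk]
      · simp [C, hkl, Ne.symm hkl]
    have hm : Measurable fun (γ : ι → ℂ) (k : ι) => ∑ l, C k l * γ l := by fun_prop
    have h1 : ∫ γ : ι → ℂ, γ i * starRingEnd ℂ (γ j) ∂(Measure.pi fun _ => complexGaussian) =
        -∫ γ : ι → ℂ, γ i * starRingEnd ℂ (γ j) ∂(Measure.pi fun _ => complexGaussian) := by
      conv_lhs => rw [← map_pi_complexGaussian C hC]
      rw [integral_map hm.aemeasurable (by
        exact (by fun_prop : Continuous fun γ : ι → ℂ =>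
          γ i * starRingEnd ℂ (γ j)).aestronglyMeasurable), ← integral_neg]
      refine integral_congr_ae (Filter.Eventually.of_forall fun γ => ?_)
      simp [C, Ne.symm h]
    exact self_eq_neg.1 h1

theorem one_le_integral_sq_norm_complexGaussian : 1 ≤ ∫ z, ‖z‖ ^ 2 ∂complexGaussian := by
  have h1 := memLp_complexGaussian.eLpNorm_eq_integral_rpow_norm (by norm_num) (by norm_num)
  have h2 := one_le_eLpNorm_complexGaussian
  rw [h1, ENNReal.one_le_ofReal] at h2
  by_contra! h
  have h3 := Real.rpow_lt_one (integral_nonneg fun z : ℂ => sq_nonneg ‖z‖) h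
    (z := (2 : ℝ≥0∞).toReal⁻¹) (by norm_num)
  simp only [ENNReal.toReal_ofNat, Real.rpow_ofNat] at h2 h3
  linarith

theorem memLp_eval_pi_complexGaussian {ι : Type*} [Fintype ι] (i : ι) :
    MemLp (fun γ : ι → ℂ => γ i) 2 (Measure.pi fun _ => complexGaussian) :=
  memLp_complexGaussian.comp_measurePreserving (measurePreserving_eval _ i)

/-- By orthogonality of the coordinates, the expectation of the pairing of `∑ γᵢ xᵢ` with `∑ γ̄ⱼ yⱼ`
is `𝔼|γ|² ∑ yᵢ(xᵢ)`, and Cauchy–Schwarz bounds it. The conjugates are needed because the pairing of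
`X'` with `X` is bilinear; they do not change the norm of the second sum. -/
theorem enorm_sum_apply_le_gaussianSumNorm {X : Type*} [NormedAddCommGroup X] [NormedSpace ℂ X]
    {ι : Type*} [Fintype ι] (x : ι → X) (y : ι → StrongDual ℂ X) :
    ‖∑ i, y i (x i)‖ₑ ≤ gaussianSumNorm y * gaussianSumNorm x := by
  classical
  let c : ℝ := ∫ z, ‖z‖ ^ 2 ∂complexGaussian
  let A : (ι → ℂ) → StrongDual ℂ X := fun γ => ∑ j, starRingEnd ℂ (γ j) • y j
  let B : (ι → ℂ) → X := fun γ => ∑ i, γ i • x i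
  have hint : ∀ i j, Integrable (fun γ : ι → ℂ => γ i * starRingEnd ℂ (γ j) * y j (x i))
      (Measure.pi fun _ => complexGaussian) := fun i j =>
    ((memLp_eval_pi_complexGaussian i).integrable_mul
      (memLp_eval_pi_complexGaussian j).star).mul_const _
  have hAB : ∀ γ, A γ (B γ) = ∑ i, ∑ j, γ i * starRingEnd ℂ (γ j) * y j (x i) := by
    intro γ
    simp only [A, B, map_sum, map_smul, sum_apply, smul_apply, smul_eq_mul, Finset.mul_sum]
    refine Finset.sum_congr rfl fun i _ => Finset.sum_congr rfl fun j _ => ?_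
    ring
  have h1 : ∫ γ, A γ (B γ) ∂(Measure.pi fun _ => complexGaussian) = (c : ℂ) * ∑ i, y i (x i) := by
    simp only [hAB]
    rw [integral_finsetSum _ fun i _ => integrable_finsetSum _ fun j _ => hint i j,
      Finset.mul_sum]
    refine Finset.sum_congr rfl fun i _ => ?_
    rw [integral_finsetSum _ fun j _ => hint i j]
    simp only [integral_mul_const, integral_mul_conj_pi_complexGaussian, ite_mul, zero_mul,
      Finset.sum_ite_eq, Finset.mem_univ, if_true, c]
  -- The factor `c = 𝔼|γ|²` is at least `1` and can be dropped.
  have h2 : ‖∑ i, y i (x i)‖ₑ ≤ ‖∫ γ, A γ (B γ) ∂(Measure.pi fun _ => complexGaussian)‖ₑ := by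
    rw [h1, enorm_mul]
    refine le_mul_of_one_le_left' ?_
    rw [← ofReal_norm, Complex.norm_real, ENNReal.one_le_ofReal]
    exact one_le_integral_sq_norm_complexGaussian.trans (le_abs_self _)
  have hA : Continuous A := by fun_prop
  -- Hölder for the evaluation pairing, whose bound is `1`.
  have h3 := eLpNorm_le_eLpNorm_mul_eLpNorm_of_nnnorm (p := 2) (q := 2) (r := 1)
    (μ := Measure.pi fun _ => complexGaussian) hA.aestronglyMeasurable
    (continuous_gaussianSum x).aestronglyMeasurable (fun f v => f v) 1
    (Filter.Eventually.of_forall fun γ => by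
      rw [one_mul]; exact ContinuousLinearMap.le_opNNNorm _ _)
  refine h2.trans ((enorm_integral_le_lintegral_enorm _).trans ?_)
  rw [eLpNorm_one_eq_lintegral_enorm, ENNReal.coe_one, one_mul, gaussianSumNorm_conj] at h3
  exact h3

variable {H : Type*} [NormedAddCommGroup H] [InnerProductSpace ℂ H] [CompleteSpace H]
  {X : Type*} [NormedAddCommGroup X] [NormedSpace ℂ X]

theorem orthonormal_toDual {ι : Type*} {e : ι → H} (he : Orthonormal ℂ e) :
    Orthonormal ℂ fun i => InnerProductSpace.toDual ℂ H (e i) := by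
  refine ⟨fun i => by rw [(InnerProductSpace.toDual ℂ H).norm_map]; exact he.1 i,
    fun i j hij => ?_⟩
  have h : inner ℂ (InnerProductSpace.toDual ℂ H (e i)) (InnerProductSpace.toDual ℂ H (e j)) =
      inner ℂ ((InnerProductSpace.toDual ℂ H).symm (InnerProductSpace.toDual ℂ H (e j)))
        ((InnerProductSpace.toDual ℂ H).symm (InnerProductSpace.toDual ℂ H (e i))) := rfl
  refine h.trans ?_
  rw [LinearIsometryEquiv.symm_apply_apply, LinearIsometryEquiv.symm_apply_apply]
  exact he.2 hij.symm

/-- Writing `U = ∑ ēᵢ ⊗ U eᵢ` gives `tr(V'U) = ∑ ⟨U eᵢ, V ēᵢ⟩`. The two Gaussian sums are tested on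
the orthonormal systems `(eᵢ)` in `H` and `(ēᵢ)` in `H'`. No approximation of `V` by finite rank
operators is involved. -/
theorem gammaDualNorm_le_gammaNorm (V : StrongDual ℂ H →L[ℂ] StrongDual ℂ X) :
    gammaDualNorm V ≤ gammaNorm V := by
  refine iSup₂_le fun U hU => ?_
  obtain ⟨n, e, he, h⟩ := exists_orthonormal_eq_sum_smulRight hU.2
  have h1 : nuclearTrace (dualComp V U) =
      ∑ i, V (InnerProductSpace.toDual ℂ H (e i)) (U (e i)) := by
    conv_lhs => rw [h]
    exact nuclearTrace_dualComp_sum_smulRight V _ _ _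
  rw [h1]
  refine (enorm_sum_apply_le_gaussianSumNorm _ _).trans ?_
  calc _ ≤ gammaNorm V * 1 :=
        mul_le_mul' (gaussianSumNorm_le_gammaNorm (orthonormal_toDual he) V)
          ((gaussianSumNorm_le_gammaNorm he U).trans hU.1)
    _ = gammaNorm V := mul_one _

end GammaNormDual

theorem mainTheorem10 {H : Type*} [NormedAddCommGroup H] [InnerProductSpace ℂ H] [CompleteSpace H]
    {X : Type*} [NormedAddCommGroup X] [NormedSpace ℂ X] [CompleteSpace X] :
    (∀ (U : GammaRad H X) (V : GammaDual H X),
      IsNuclear (dualComp V.toCLM U.toCLM) ∧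
        nuclearNorm (dualComp V.toCLM U.toCLM) ≤ ‖V‖ * ‖U‖) ∧
    (∃ Ψ : GammaDual H X →ₗᵢ[ℂ] (GammaRad H X →L[ℂ] NuclearOp H H),
      ∀ (V : GammaDual H X) (U : GammaRad H X), (Ψ V U).toCLM = dualComp V.toCLM U.toCLM) ∧
    (∃ Φ : GammaDual H X ≃ₗᵢ[ℂ] StrongDual ℂ (GammaRad H X),
      ∀ (V : GammaDual H X) (U : GammaRad H X), Φ V U = nuclearTrace (dualComp V.toCLM U.toCLM)) ∧
    (∀ {ι : Type*} (e : HilbertBasis ι ℂ H) (U : GammaRad H X) (V : GammaDual H X),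
      HasSum (fun α => V.toCLM (InnerProductSpace.toDual ℂ H (e α)) (U.toCLM (e α)))
        (nuclearTrace (dualComp V.toCLM U.toCLM))) ∧
    (∀ V : GammaRad (StrongDual ℂ H) (StrongDual ℂ X),
      ∃ W : GammaDual H X, W.toCLM = V.toCLM ∧ ‖W‖ ≤ ‖V‖) := by
  have hnuc : ∀ (U : GammaRad H X) (V : GammaDual H X), IsNuclear (dualComp V.toCLM U.toCLM) :=
    fun U V => by rw [← toCLM_gammaDualComp]; exact (gammaDualComp V U).isNuclear
  refine ⟨fun U V => ⟨hnuc U V, ?_⟩, ⟨gammaDualCompLI H X, toCLM_gammaDualComp⟩,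
    ⟨LinearIsometryEquiv.ofSurjective (gammaTraceDuality H X) gammaTraceDuality_surjective,
      gammaTraceDuality_apply⟩, fun e U V => ?_, fun V => ?_⟩
  · rw [← toCLM_gammaDualComp]
    exact (gammaDualComp V).le_of_opNorm_le (norm_gammaDualComp_le V) U
  -- The diagonal entry `ēα(V'U eα)` equals `⟨U eα, V ēα⟩`, by the definition of the adjoint.
  · refine ((hnuc U V).hasSum_inner e).congr_fun fun α => ?_
    rw [← apply_dualComp, InnerProductSpace.toDual_apply_apply]
  · have hV := GammaSumming.gammaNorm_lt_top V.1
    have hle := gammaDualNorm_le_gammaNorm V.toCLM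
    exact ⟨⟨V.toCLM, hle.trans_lt hV⟩, rfl, ENNReal.toReal_mono hV.ne hle⟩
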